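/- Let $k$ be an algebraically closed field of characteristic zero, and let $U$ and $A$ be pointed Hopf algebras over $k$ (every simple subcoalgebra is one-dimensional) whose coradicals $U_0$, $A_0$ (the sums of the simple subcoalgebras) are commutative. Call an element $a$ of a Hopf algebra $B$ skew primitive if $\Delta(a)=a\otimes g+h\otimes a$ for some group-like $g,h\in B$, and say that a skew primitive $a$ is of finite type (of finite rank) if the sub-Hopf algebra of $B$ generated by $B_0\cup\{a\}$ is a free left $B_0$-module of finite rank. Suppose that $U$ and $A$ are generated as algebras by their skew primitive elements of finite type. Let $\tau:U\otimes A\to k$ be a convolution invertible linear form such that for all $u,u'\in U$ and $a,a'\in A$: (A.1) $\tau(u,aa')=\tau(u_{(2)},a)\,\tau(u_{(1)},a')$; (A.2) $\tau(1,a)=\epsilon(a)$; (A.3) $\tau(uu',a)=\tau(u,a_{(1)})\,\tau(u',a_{(2)})$; (A.4) $\tau(u,1)=\epsilon(u)$. Let $\sigma(u\otimes a,u'\otimes a')=\epsilon(u)\tau(u',a)\epsilon(a')$, a 2-cocycle for the bialgebra $U\otimes A$, and let $H=(U\otimes A)^\sigma$ be the algebra on the vector space $U\otimes A$ with product $x\cdot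 y=\sigma(x_{(1)},y_{(1)})\,x_{(2)}y_{(2)}\,\sigma^{-1}(x_{(3)},y_{(3)})$. The maps $u\mapsto u\otimes 1$ and $a\mapsto 1\otimes a$ are algebra maps $U\to H$ and $A\to H$, by which $H$-modules are regarded as $U$-modules and as $A$-modules. Let ${}_H\underline{\mathcal M}$ be the category of those left $H$-modules $M$ which are generated by some one-dimensional $A$-submodule and have a $U$-submodule $N$ of codimension one such that $(0)$ is the only $H$-submodule of $M$ contained in $N$; its morphisms are the $H$-module maps. Let $[{}_H\underline{\mathcal M}]$ be the set of isomorphism classes of its objects. Let $\mathrm{Alg}(U,k)$, $\mathrm{Alg}(A,k)$ be the sets of algebra maps to $k$. For $\rho\in\mathrm{Alg}(U,k)$ and $\chi\in\mathrm{Alg}(A,k)$ let $U_\chi=H\otimes_A k_\chi$, where $k_\chi$ is $k$ with $A$ acting through $\chi$; identify $U_\chi$ with the vector space $U$ by $(u\otimes a)\otimes_A 1\mapsto \chi(a)u$, so that $(u\otimes a)\cdot_\chi u'=u\,\big((\mathrm{id}_U\otimes\chi)((1\otimes a)(u'\otimes 1))\big)$. Let $I(\rho,\chi)$ be the sum of all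 $H$-submodules of $U_\chi$ contained in $\mathrm{Ker}\,\rho$, and let $L(\rho,\chi)=U_\chi/I(\rho,\chi)$. Then $\mathrm{Alg}(U,k)$ and $\mathrm{Alg}(A,k)$ are abelian groups under convolution, and: a) every $L(\rho,\chi)$ is an object of ${}_H\underline{\mathcal M}$, and the map $\mathrm{Alg}(U,k)\times\mathrm{Alg}(A,k)\to[{}_H\underline{\mathcal M}]$, $(\rho,\chi)\mapsto[L(\rho,\chi)]$, is bijective. b) Every object of ${}_H\underline{\mathcal M}$ has a unique one-dimensional $A$-submodule and a unique codimension one $U$-submodule. c) Suppose that the finite-dimensional irreducible left $U$-modules and the finite-dimensional irreducible left $A$-modules are one-dimensional. Then the finite-dimensional irreducible left $H$-modules are exactly the finite-dimensional objects of ${}_H\underline{\mathcal M}$. -/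

import Mathlib

open scoped TensorProduct

universe u v w

noncomputable section

/-! ### Subcoalgebras, the coradical, pointedness -/

namespace HopfSub

variable (k : Type*) [Field k] {A : Type*}

/-- A subspace `C` is a subcoalgebra if `Δ(C) ⊆ C ⊗ C`. -/
def IsSubcoalgebra [AddCommGroup A] [Module k A] [Coalgebra k A] (C : Submodule k A) : Prop :=
  ∀ c ∈ C, Coalgebra.comul (R := k) c ∈ LinearMap.range (TensorProduct.mapIncl C C)

/-- A simple subcoalgebra: nonzero, with no subcoalgebras except `0` and itself. -/
structure IsSimpleSubcoalgebra [AddCommGroup A] [Module k A] [Coalgebra k A]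
    (C : Submodule k A) : Prop where
  isSubcoalgebra : IsSubcoalgebra k C
  ne_bot : C ≠ ⊥
  eq_bot_or_eq : ∀ D : Submodule k A, IsSubcoalgebra k D → D ≤ C → D = ⊥ ∨ D = C

/-- The coradical: the sum of all simple subcoalgebras. -/
def coradical (A : Type*) [AddCommGroup A] [Module k A] [Coalgebra k A] : Submodule k A :=
  sSup {C | IsSimpleSubcoalgebra k C}

/-- A coalgebra is pointed if all its simple subcoalgebras are one-dimensional. -/
def IsPointed (A : Type*) [AddCommGroup A] [Module k A] [Coalgebra k A] : Prop :=
  ∀ C : Submodule k A, IsSimpleSubcoalgebra k C → Module.finrank k C = 1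

/-- Any two elements of the coradical commute. -/
def HasCommutativeCoradical (A : Type*) [Ring A] [Bialgebra k A] : Prop :=
  ∀ x ∈ coradical k A, ∀ y ∈ coradical k A, x * y = y * x

variable [Ring A] [HopfAlgebra k A]

/-- A sub-Hopf algebra: a subalgebra which is a subcoalgebra and is stable under the antipode. -/
structure IsSubHopfAlgebra (E : Subalgebra k A) : Prop where
  isSubcoalgebra : IsSubcoalgebra k (Subalgebra.toSubmodule E)
  antipode_mem : ∀ x ∈ E, HopfAlgebra.antipode k x ∈ E

/-- The sub-Hopf algebra generated by a set: the intersection of all sub-Hopf algebras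
containing it. -/
def hopfClosure (s : Set A) : Subalgebra k A :=
  sInf {E | IsSubHopfAlgebra k E ∧ s ⊆ E}

/-- `a` is skew primitive: `Δ(a) = a ⊗ g + h ⊗ a` for some group-like elements `g`, `h`. -/
def IsSkewPrimitive (a : A) : Prop :=
  ∃ g h : A, IsGroupLikeElem k g ∧ IsGroupLikeElem k h ∧
    Coalgebra.comul (R := k) a = a ⊗ₜ[k] g + h ⊗ₜ[k] a

/-- The coradical as a subalgebra. For a pointed Hopf algebra the coradical is closed under
multiplication, so that taking the generated subalgebra adds nothing. -/
def coradicalSubalgebra (A : Type*) [Ring A] [HopfAlgebra k A] : Subalgebra k A :=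
  Algebra.adjoin k (coradical k A : Set A)

/-- The sub-Hopf algebra generated by the coradical and `a`, as a left module over the
coradical. -/
def hopfExtension (a : A) : Submodule (coradicalSubalgebra k A) A where
  carrier := hopfClosure k ((coradical k A : Set A) ∪ {a})
  add_mem' := add_mem
  zero_mem' := zero_mem _
  smul_mem' b x hx := by
    refine mul_mem ?_ hx
    have h : coradicalSubalgebra k A ≤ hopfClosure k ((coradical k A : Set A) ∪ {a}) :=
      le_sInf fun E hE => Algebra.adjoin_le (Set.subset_union_left.trans hE.2)
    exact h b.2

/-- `a` is of finite type (finite rank): the sub-Hopf algebra generated by the coradical and `a`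
is a free left module of finite rank over the coradical. -/
def IsOfFiniteType (a : A) : Prop :=
  Module.Free (coradicalSubalgebra k A) (hopfExtension k a) ∧
    Module.Finite (coradicalSubalgebra k A) (hopfExtension k a)

/-- `A` is generated as an algebra by its skew primitive elements of finite type. -/
def GeneratedByFiniteTypeSkewPrimitives (A : Type*) [Ring A] [HopfAlgebra k A] : Prop :=
  Algebra.adjoin k {a : A | IsSkewPrimitive k a ∧ IsOfFiniteType k a} = ⊤

end HopfSub

/-! ### Twisting the multiplication of a bialgebra by a 2-cocycle -/

namespace CocycleTwist

open WithConv

variable {k B C : Type*} [Field k] [Ring B] [Bialgebra k B]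
  [AddCommGroup C] [Module k C] [Coalgebra k C]

/-- A linear form regarded as a map with values in an algebra `D`. -/
def scal (D : Type*) [Ring D] [Algebra k D] (f : WithConv (C →ₗ[k] k)) : WithConv (C →ₗ[k] D) :=
  toConv (Algebra.linearMap k D ∘ₗ f.ofConv)

/-- The twisted multiplication
`x ⊗ y ↦ σ(x₍₁₎, y₍₁₎) x₍₂₎ y₍₂₎ σ⁻¹(x₍₃₎, y₍₃₎)`, a threefold convolution product of maps
`B ⊗ B → B`. -/
def twistMul (σ : (WithConv (B ⊗[k] B →ₗ[k] k))ˣ) : B ⊗[k] B →ₗ[k] B :=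
  (scal B σ.val * toConv (LinearMap.mul' k B) * scal B σ⁻¹.val).ofConv

/-- The 2-cocycle condition
`σ(x₍₁₎, y₍₁₎) σ(x₍₂₎ y₍₂₎, z) = σ(y₍₁₎, z₍₁₎) σ(x, y₍₂₎ z₍₂₎)`,
as an equality of convolution products of linear forms on `(B ⊗ B) ⊗ B`. -/
def IsTwoCocycle (σ : B ⊗[k] B →ₗ[k] k) : Prop :=
  toConv (LinearMap.mul' k k ∘ₗ TensorProduct.map σ (Coalgebra.counit (R := k) (A := B))) *
      toConv (σ ∘ₗ TensorProduct.map (LinearMap.mul' k B) LinearMap.id) =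
    toConv (LinearMap.mul' k k ∘ₗ TensorProduct.map (Coalgebra.counit (R := k) (A := B)) σ ∘ₗ
        (TensorProduct.assoc k B B B).toLinearMap) *
      toConv (σ ∘ₗ TensorProduct.map LinearMap.id (LinearMap.mul' k B) ∘ₗ
        (TensorProduct.assoc k B B B).toLinearMap)

/-! #### Associativity of the twisted multiplication -/

/-- Precomposition with a coalgebra map is multiplicative for convolution. -/
def pull {D : Type*} [AddCommGroup D] [Module k D] [Coalgebra k D] (E : Type*) [Ring E]
    [Algebra k E] (h : C →ₗc[k] D) :
    WithConv (D →ₗ[k] E) →* WithConv (C →ₗ[k] E) where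
  toFun f := toConv (f.ofConv ∘ₗ h.toLinearMap)
  map_one' := by
    ext c
    simp
  map_mul' f g := by
    rw [LinearMap.convMul_comp_coalgHom_distrib]

theorem scal_mul (D : Type*) [Ring D] [Algebra k D] (f g : WithConv (C →ₗ[k] k)) :
    scal D (f * g) = scal D f * scal D g := by
  have h := LinearMap.algHom_comp_convMul_distrib (Algebra.ofId k D) f g
  exact congrArg toConv h

theorem scal_one (D : Type*) [Ring D] [Algebra k D] :
    scal D (1 : WithConv (C →ₗ[k] k)) = 1 := by
  ext c
  simp [scal]

theorem comp_scal_mul {D E : Type*} [Ring D] [Algebra k D] [Ring E] [Algebra k E]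
    (Φ : D →ₗ[k] E) (f : WithConv (C →ₗ[k] k)) (F : WithConv (C →ₗ[k] D)) :
    toConv (Φ ∘ₗ (scal D f * F).ofConv) = scal E f * toConv (Φ ∘ₗ F.ofConv) := by
  ext c
  change Φ ((scal D f * F) c) = _
  rw [(Coalgebra.Repr.arbitrary k c).convMul_apply, (Coalgebra.Repr.arbitrary k c).convMul_apply]
  simp [scal, ← Algebra.smul_def]

theorem comp_mul_scal {D E : Type*} [Ring D] [Algebra k D] [Ring E] [Algebra k E]
    (Φ : D →ₗ[k] E) (f : WithConv (C →ₗ[k] k)) (F : WithConv (C →ₗ[k] D)) :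
    toConv (Φ ∘ₗ (F * scal D f).ofConv) = toConv (Φ ∘ₗ F.ofConv) * scal E f := by
  ext c
  change Φ ((F * scal D f) c) = _
  rw [(Coalgebra.Repr.arbitrary k c).convMul_apply, (Coalgebra.Repr.arbitrary k c).convMul_apply]
  simp [scal, ← Algebra.smul_def, ← Algebra.commutes]

/-- Restricting the twisted multiplication along a coalgebra map. -/
theorem twistMul_comp (σ : (WithConv (B ⊗[k] B →ₗ[k] k))ˣ) (h : C →ₗc[k] B ⊗[k] B) :
    toConv (twistMul σ ∘ₗ h.toLinearMap) =
      scal B (Units.map (pull k h) σ).val * toConv (LinearMap.mul' k B ∘ₗ h.toLinearMap) *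
        scal B ((Units.map (pull k h) σ)⁻¹).val := by
  exact (map_mul (pull B h) (scal B σ.val * toConv (LinearMap.mul' k B)) (scal B σ⁻¹.val)).trans
    (congrArg (· * _) (map_mul (pull B h) (scal B σ.val) (toConv (LinearMap.mul' k B))))

variable (k B) in
/-- The coalgebra map `x ⊗ y ⊗ z ↦ (x ⊗ y) ε(z)`. -/
def p12 : (B ⊗[k] B) ⊗[k] B →ₗc[k] B ⊗[k] B :=
  (Coalgebra.TensorProduct.rid k k (B ⊗[k] B)).toCoalgHom.comp
    (Coalgebra.TensorProduct.map (CoalgHom.id k _) (Coalgebra.counitCoalgHom k B))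

variable (k B) in
/-- The coalgebra map `x ⊗ y ⊗ z ↦ ε(x) (y ⊗ z)`. -/
def p23 : (B ⊗[k] B) ⊗[k] B →ₗc[k] B ⊗[k] B :=
  ((Coalgebra.TensorProduct.lid k (B ⊗[k] B)).toCoalgHom.comp
    (Coalgebra.TensorProduct.map (Coalgebra.counitCoalgHom k B) (CoalgHom.id k _))).comp
    (Coalgebra.TensorProduct.assoc k k B B B).toCoalgHom

variable (k B) in
/-- The coalgebra map `x ⊗ y ⊗ z ↦ xy ⊗ z`. -/
def m12 : (B ⊗[k] B) ⊗[k] B →ₗc[k] B ⊗[k] B :=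
  Coalgebra.TensorProduct.map (Bialgebra.mulCoalgHom k B) (CoalgHom.id k _)

variable (k B) in
/-- The coalgebra map `x ⊗ y ⊗ z ↦ x ⊗ yz`. -/
def m23 : (B ⊗[k] B) ⊗[k] B →ₗc[k] B ⊗[k] B :=
  (Coalgebra.TensorProduct.map (CoalgHom.id k _) (Bialgebra.mulCoalgHom k B)).comp
    (Coalgebra.TensorProduct.assoc k k B B B).toCoalgHom

theorem isTwoCocycle_iff (σ : (WithConv (B ⊗[k] B →ₗ[k] k))ˣ) :
    IsTwoCocycle σ.val.ofConv ↔
      Units.map (pull k (p12 k B)) σ * Units.map (pull k (m12 k B)) σ =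
        Units.map (pull k (p23 k B)) σ * Units.map (pull k (m23 k B)) σ := by
  rw [Units.ext_iff]
  unfold IsTwoCocycle
  have h1 : toConv (LinearMap.mul' k k ∘ₗ
      TensorProduct.map σ.val.ofConv (Coalgebra.counit (R := k) (A := B))) =
      (Units.map (pull k (p12 k B)) σ).val := by
    apply WithConv.ext
    apply TensorProduct.ext_threefold
    intro x y z
    change σ.val.ofConv (x ⊗ₜ y) * Coalgebra.counit (R := k) z =
      σ.val.ofConv (Coalgebra.counit (R := k) z • (x ⊗ₜ y))
    rw [LinearMap.map_smul, smul_eq_mul, mul_comm]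
  have h2 : toConv (LinearMap.mul' k k ∘ₗ
      TensorProduct.map (Coalgebra.counit (R := k) (A := B)) σ.val.ofConv ∘ₗ
        (TensorProduct.assoc k B B B).toLinearMap) =
      (Units.map (pull k (p23 k B)) σ).val := by
    apply WithConv.ext
    apply TensorProduct.ext_threefold
    intro x y z
    change Coalgebra.counit (R := k) x * σ.val.ofConv (y ⊗ₜ z) =
      σ.val.ofConv (Coalgebra.counit (R := k) x • (y ⊗ₜ z))
    rw [LinearMap.map_smul, smul_eq_mul]
  rw [h1, h2]
  rfl

theorem twistMul_rTensor (σ : (WithConv (B ⊗[k] B →ₗ[k] k))ˣ) :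
    toConv (TensorProduct.map (twistMul σ) (LinearMap.id : B →ₗ[k] B)) =
      scal (B ⊗[k] B) (Units.map (pull k (p12 k B)) σ).val * toConv (m12 k B).toLinearMap *
        scal (B ⊗[k] B) ((Units.map (pull k (p12 k B)) σ)⁻¹).val := by
  have hs : ∀ f : WithConv (B ⊗[k] B →ₗ[k] k), scal (B ⊗[k] B) (pull k (p12 k B) f) =
      toConv (TensorProduct.map (scal B f).ofConv (1 : WithConv (B →ₗ[k] B)).ofConv) := by
    intro f
    apply WithConv.ext
    apply TensorProduct.ext_threefold
    intro x y z
    change algebraMap k (B ⊗[k] B) (f.ofConv (Coalgebra.counit (R := k) z • (x ⊗ₜ y))) =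
      algebraMap k B (f.ofConv (x ⊗ₜ y)) ⊗ₜ algebraMap k B (Coalgebra.counit (R := k) z)
    rw [LinearMap.map_smul, smul_eq_mul, Algebra.algebraMap_eq_smul_one,
      Algebra.algebraMap_eq_smul_one, Algebra.algebraMap_eq_smul_one,
      TensorProduct.smul_tmul_smul, Algebra.TensorProduct.one_def, mul_comm]
  change _ = scal (B ⊗[k] B) (pull k (p12 k B) σ.val) * toConv (m12 k B).toLinearMap *
        scal (B ⊗[k] B) (pull k (p12 k B) σ⁻¹.val)
  rw [hs, hs]
  have h2 : toConv (m12 k B).toLinearMap =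
      toConv (TensorProduct.map (toConv (LinearMap.mul' k B)).ofConv
        (toConv (LinearMap.id : B →ₗ[k] B)).ofConv) := rfl
  rw [h2, TensorProduct.map_convMul_map, TensorProduct.map_convMul_map, one_mul, mul_one]
  rfl

theorem twistMul_lTensor (σ : (WithConv (B ⊗[k] B →ₗ[k] k))ˣ) :
    toConv (TensorProduct.map (LinearMap.id : B →ₗ[k] B) (twistMul σ) ∘ₗ
        (TensorProduct.assoc k B B B).toLinearMap) =
      scal (B ⊗[k] B) (Units.map (pull k (p23 k B)) σ).val * toConv (m23 k B).toLinearMap *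
        scal (B ⊗[k] B) ((Units.map (pull k (p23 k B)) σ)⁻¹).val := by
  let α : (B ⊗[k] B) ⊗[k] B →ₗc[k] B ⊗[k] (B ⊗[k] B) :=
    (Coalgebra.TensorProduct.assoc k k B B B).toCoalgHom
  have hs : ∀ f : WithConv (B ⊗[k] B →ₗ[k] k), scal (B ⊗[k] B) (pull k (p23 k B) f) =
      pull (B ⊗[k] B) α
        (toConv (TensorProduct.map (1 : WithConv (B →ₗ[k] B)).ofConv (scal B f).ofConv)) := by
    intro f
    apply WithConv.ext
    apply TensorProduct.ext_threefold
    intro x y z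
    change algebraMap k (B ⊗[k] B) (f.ofConv (Coalgebra.counit (R := k) x • (y ⊗ₜ z))) =
      algebraMap k B (Coalgebra.counit (R := k) x) ⊗ₜ algebraMap k B (f.ofConv (y ⊗ₜ z))
    rw [LinearMap.map_smul, smul_eq_mul, Algebra.algebraMap_eq_smul_one,
      Algebra.algebraMap_eq_smul_one, Algebra.algebraMap_eq_smul_one,
      TensorProduct.smul_tmul_smul, Algebra.TensorProduct.one_def]
  change _ = scal (B ⊗[k] B) (pull k (p23 k B) σ.val) * toConv (m23 k B).toLinearMap *
        scal (B ⊗[k] B) (pull k (p23 k B) σ⁻¹.val)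
  rw [hs, hs]
  have h2 : toConv (m23 k B).toLinearMap =
      pull (B ⊗[k] B) α (toConv (TensorProduct.map
        (toConv (LinearMap.id : B →ₗ[k] B)).ofConv (toConv (LinearMap.mul' k B)).ofConv)) := rfl
  rw [h2, ← map_mul, ← map_mul, TensorProduct.map_convMul_map, TensorProduct.map_convMul_map,
    one_mul, mul_one]
  rfl

/-- The multiplication twisted by a 2-cocycle is associative. -/
theorem twistMul_assoc (σ : (WithConv (B ⊗[k] B →ₗ[k] k))ˣ) (hσ : IsTwoCocycle σ.val.ofConv)
    (x y z : B) :
    twistMul σ (twistMul σ (x ⊗ₜ[k] y) ⊗ₜ[k] z) =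
      twistMul σ (x ⊗ₜ[k] twistMul σ (y ⊗ₜ[k] z)) := by
  rw [isTwoCocycle_iff] at hσ
  have key : toConv (twistMul σ ∘ₗ TensorProduct.map (twistMul σ) (LinearMap.id : B →ₗ[k] B)) =
      toConv (twistMul σ ∘ₗ TensorProduct.map (LinearMap.id : B →ₗ[k] B) (twistMul σ) ∘ₗ
        (TensorProduct.assoc k B B B).toLinearMap) := by
    have e1 := congrArg (fun F => toConv (twistMul σ ∘ₗ F.ofConv)) (twistMul_rTensor σ)
    have e2 := congrArg (fun F => toConv (twistMul σ ∘ₗ F.ofConv)) (twistMul_lTensor σ)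
    simp only [comp_mul_scal, comp_scal_mul, twistMul_comp] at e1 e2
    rw [e1, e2]
    have hm : LinearMap.mul' k B ∘ₗ (m12 k B).toLinearMap =
        LinearMap.mul' k B ∘ₗ (m23 k B).toLinearMap := by
      apply TensorProduct.ext_threefold
      intro x y z
      simp [m12, m23, mul_assoc]
    have hinv := congrArg (fun s => s⁻¹) hσ
    simp only [mul_inv_rev] at hinv
    have a1 := congrArg (fun s : (WithConv ((B ⊗[k] B) ⊗[k] B →ₗ[k] k))ˣ => scal B s.val) hσ
    have a2 := congrArg (fun s : (WithConv ((B ⊗[k] B) ⊗[k] B →ₗ[k] k))ˣ => scal B s.val) hinv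
    simp only [Units.val_mul, scal_mul] at a1 a2
    rw [hm]
    simp only [← mul_assoc]
    rw [a1]
    simp only [mul_assoc]
    rw [a2]
  exact DFunLike.congr_fun (congrArg WithConv.ofConv key) ((x ⊗ₜ[k] y) ⊗ₜ[k] z)

end CocycleTwist

/-! ### The bialgebra pairings and the algebra `H = (U ⊗ A)^σ` -/

/-- A convolution invertible linear form `τ : U ⊗ A → k` with
* `τ(u, aa') = τ(u₍₂₎, a) τ(u₍₁₎, a')`,
* `τ(1, a) = ε(a)`,
* `τ(uu', a) = τ(u, a₍₁₎) τ(u', a₍₂₎)`,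
* `τ(u, 1) = ε(u)`.

Here `Coalgebra.Repr.arbitrary k x` is a presentation `Δ(x) = ∑ i, left i ⊗ right i`. -/
structure SkewPairing (k U A : Type*) [Field k] [Ring U] [Bialgebra k U] [Ring A]
    [Bialgebra k A] where
  form : U ⊗[k] A →ₗ[k] k
  isUnit_form : IsUnit (WithConv.toConv form)
  form_mul_right : ∀ (u : U) (a a' : A), form (u ⊗ₜ[k] (a * a')) =
    ∑ i ∈ (Coalgebra.Repr.arbitrary k u).index,
      form ((Coalgebra.Repr.arbitrary k u).right i ⊗ₜ[k] a) *
        form ((Coalgebra.Repr.arbitrary k u).left i ⊗ₜ[k] a')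
  form_one_left : ∀ a : A, form (1 ⊗ₜ[k] a) = Coalgebra.counit (R := k) a
  form_mul_left : ∀ (u u' : U) (a : A), form ((u * u') ⊗ₜ[k] a) =
    ∑ i ∈ (Coalgebra.Repr.arbitrary k a).index,
      form (u ⊗ₜ[k] (Coalgebra.Repr.arbitrary k a).left i) *
        form (u' ⊗ₜ[k] (Coalgebra.Repr.arbitrary k a).right i)
  form_one_right : ∀ u : U, form (u ⊗ₜ[k] 1) = Coalgebra.counit (R := k) u

namespace SkewPairing

open WithConv CocycleTwist

variable {k U A : Type*} [Field k] [Ring U] [Bialgebra k U] [Ring A] [Bialgebra k A]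

variable (k U A) in
/-- The coalgebra map `u ⊗ a ↦ ε(u) a`. -/
def projA : U ⊗[k] A →ₗc[k] A :=
  (Coalgebra.TensorProduct.lid k A).toCoalgHom.comp
    (Coalgebra.TensorProduct.map (Coalgebra.counitCoalgHom k U) (CoalgHom.id k A))

variable (k U A) in
/-- The coalgebra map `u ⊗ a ↦ ε(a) u`. -/
def projU : U ⊗[k] A →ₗc[k] U :=
  (Coalgebra.TensorProduct.rid k k U).toCoalgHom.comp
    (Coalgebra.TensorProduct.map (CoalgHom.id k U) (Coalgebra.counitCoalgHom k A))

variable (k U A) in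
/-- The twist map `a ⊗ u ↦ u ⊗ a` as a coalgebra map. -/
def swap : A ⊗[k] U →ₗc[k] U ⊗[k] A :=
  ((Bialgebra.TensorProduct.comm k A U : A ⊗[k] U ≃ₐc[k] U ⊗[k] A) :
    A ⊗[k] U →ₗc[k] U ⊗[k] A)

variable (k U A) in
/-- The coalgebra map `(u ⊗ a) ⊗ (u' ⊗ a') ↦ ε(u) ε(a') u' ⊗ a`. -/
def proj : (U ⊗[k] A) ⊗[k] (U ⊗[k] A) →ₗc[k] U ⊗[k] A :=
  (swap k U A).comp (Coalgebra.TensorProduct.map (projA k U A) (projU k U A))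

theorem proj_tmul (u u' : U) (a a' : A) :
    proj k U A ((u ⊗ₜ a) ⊗ₜ (u' ⊗ₜ a')) =
      (Coalgebra.counit (R := k) a' • u') ⊗ₜ[k] (Coalgebra.counit (R := k) u • a) := rfl

/-- The linear form `σ(u ⊗ a, u' ⊗ a') = ε(u) τ(u', a) ε(a')`, together with its convolution
inverse. -/
def sigma (τ : SkewPairing k U A) : (WithConv ((U ⊗[k] A) ⊗[k] (U ⊗[k] A) →ₗ[k] k))ˣ :=
  Units.map (pull k (proj k U A)) τ.isUnit_form.unit

theorem sigma_tmul (τ : SkewPairing k U A) (u u' : U) (a a' : A) :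
    τ.sigma.val.ofConv ((u ⊗ₜ a) ⊗ₜ (u' ⊗ₜ a')) =
      Coalgebra.counit (R := k) u * τ.form (u' ⊗ₜ a) * Coalgebra.counit (R := k) a' := by
  change τ.form (proj k U A ((u ⊗ₜ a) ⊗ₜ (u' ⊗ₜ a'))) = _
  rw [proj_tmul, TensorProduct.smul_tmul_smul, map_smul, smul_eq_mul]
  ring

/-! #### The form `σ` is a 2-cocycle -/

theorem sum_counit_mul {M : Type*} [AddCommGroup M] [Module k M] [Coalgebra k M] (f : M →ₗ[k] k)
    (x : M) : ∑ i ∈ (Coalgebra.Repr.arbitrary k x).index,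
      Coalgebra.counit (R := k) ((Coalgebra.Repr.arbitrary k x).left i) *
        f ((Coalgebra.Repr.arbitrary k x).right i) = f x := by
  conv_rhs => rw [← Coalgebra.sum_counit_smul (Coalgebra.Repr.arbitrary k x)]
  simp

theorem sum_mul_counit {M : Type*} [AddCommGroup M] [Module k M] [Coalgebra k M] (f : M →ₗ[k] k)
    (x : M) : ∑ i ∈ (Coalgebra.Repr.arbitrary k x).index,
      f ((Coalgebra.Repr.arbitrary k x).left i) *
        Coalgebra.counit (R := k) ((Coalgebra.Repr.arbitrary k x).right i) = f x := by
  have h := congrArg (TensorProduct.lift ((LinearMap.mul k k).compl₁₂ f LinearMap.id))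
    (Coalgebra.sum_tmul_counit_eq (Coalgebra.Repr.arbitrary k x))
  simpa only [map_sum, TensorProduct.lift.tmul, LinearMap.compl₁₂_apply, LinearMap.mul_apply',
    LinearMap.id_apply, mul_one] using h

/-- The form `a ⊗ u ↦ τ(u, a)`. -/
def flipForm (τ : SkewPairing k U A) : WithConv (A ⊗[k] U →ₗ[k] k) :=
  pull k (swap k U A) (toConv τ.form)

theorem flipForm_tmul (τ : SkewPairing k U A) (a : A) (u : U) :
    τ.flipForm.ofConv (a ⊗ₜ u) = τ.form (u ⊗ₜ a) := rfl

theorem pull_mul_right (τ : SkewPairing k U A) :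
    pull k (Coalgebra.TensorProduct.map (Bialgebra.mulCoalgHom k A) (CoalgHom.id k U))
        τ.flipForm =
      pull k (Coalgebra.TensorProduct.map (projA k A A) (CoalgHom.id k U)) τ.flipForm *
        pull k (Coalgebra.TensorProduct.map (projU k A A) (CoalgHom.id k U)) τ.flipForm := by
  apply WithConv.ext
  apply TensorProduct.ext_threefold
  intro a b w
  let ra := Coalgebra.Repr.arbitrary k a
  let rb := Coalgebra.Repr.arbitrary k b
  let rw' := Coalgebra.Repr.arbitrary k w
  refine Eq.trans ?_ (((ra.tmul rb).tmul rw').convMul_apply _ _).symm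
  change τ.form (w ⊗ₜ (a * b)) = ∑ p ∈ (ra.index ×ˢ rb.index) ×ˢ rw'.index,
    τ.form (rw'.left p.2 ⊗ₜ (Coalgebra.counit (R := k) (ra.left p.1.1) • rb.left p.1.2)) *
    τ.form (rw'.right p.2 ⊗ₜ (Coalgebra.counit (R := k) (rb.right p.1.2) • ra.right p.1.1))
  rw [form_mul_right, Finset.sum_product_right]
  refine Finset.sum_congr rfl fun l _ => ?_
  rw [Finset.sum_product]
  have h1 := sum_counit_mul (τ.form ∘ₗ TensorProduct.mk k U A (rw'.right l)) a
  have h2 := sum_mul_counit (τ.form ∘ₗ TensorProduct.mk k U A (rw'.left l)) b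
  change τ.form (rw'.right l ⊗ₜ a) * τ.form (rw'.left l ⊗ₜ b) = _
  change _ = τ.form (rw'.right l ⊗ₜ a) at h1
  change _ = τ.form (rw'.left l ⊗ₜ b) at h2
  rw [← h1, ← h2, Finset.sum_mul_sum]
  refine Finset.sum_congr rfl fun i _ => Finset.sum_congr rfl fun j _ => ?_
  simp only [TensorProduct.tmul_smul, map_smul, smul_eq_mul, LinearMap.comp_apply,
    TensorProduct.mk_apply]
  ring

theorem pull_mul_left (τ : SkewPairing k U A) :
    pull k (Coalgebra.TensorProduct.map (CoalgHom.id k A) (Bialgebra.mulCoalgHom k U))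
        τ.flipForm =
      pull k (Coalgebra.TensorProduct.map (CoalgHom.id k A) (projU k U U)) τ.flipForm *
        pull k (Coalgebra.TensorProduct.map (CoalgHom.id k A) (projA k U U)) τ.flipForm := by
  apply WithConv.ext
  apply TensorProduct.ext
  ext a : 1
  apply TensorProduct.ext'
  intro v w
  let ra := Coalgebra.Repr.arbitrary k a
  let rv := Coalgebra.Repr.arbitrary k v
  let rw' := Coalgebra.Repr.arbitrary k w
  refine Eq.trans ?_ ((ra.tmul (rv.tmul rw')).convMul_apply _ _).symm
  change τ.form ((v * w) ⊗ₜ a) = ∑ p ∈ ra.index ×ˢ (rv.index ×ˢ rw'.index),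
    τ.form ((Coalgebra.counit (R := k) (rw'.left p.2.2) • rv.left p.2.1) ⊗ₜ ra.left p.1) *
    τ.form ((Coalgebra.counit (R := k) (rv.right p.2.1) • rw'.right p.2.2) ⊗ₜ ra.right p.1)
  rw [form_mul_left, Finset.sum_product]
  refine Finset.sum_congr rfl fun l _ => ?_
  rw [Finset.sum_product]
  have h1 := sum_mul_counit (τ.form ∘ₗ (TensorProduct.mk k U A).flip (ra.left l)) v
  have h2 := sum_counit_mul (τ.form ∘ₗ (TensorProduct.mk k U A).flip (ra.right l)) w
  change τ.form (v ⊗ₜ ra.left l) * τ.form (w ⊗ₜ ra.right l) = _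
  change _ = τ.form (v ⊗ₜ ra.left l) at h1
  change _ = τ.form (w ⊗ₜ ra.right l) at h2
  rw [← h1, ← h2, Finset.sum_mul_sum]
  refine Finset.sum_congr rfl fun i _ => Finset.sum_congr rfl fun j _ => ?_
  simp only [← TensorProduct.smul_tmul', map_smul, smul_eq_mul, LinearMap.comp_apply,
    TensorProduct.mk_apply, LinearMap.flip_apply]
  ring

/-- Forms depending on different tensor factors commute for convolution. -/
theorem pull_comm {X Y : Type*} [Ring X] [Bialgebra k X] [Ring Y] [Bialgebra k Y]
    (f : WithConv (X →ₗ[k] k)) (g : WithConv (Y →ₗ[k] k)) :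
    pull k (projU k X Y) f * pull k (projA k X Y) g =
      pull k (projA k X Y) g * pull k (projU k X Y) f := by
  have hf : pull k (projU k X Y) f = toConv ((Algebra.TensorProduct.lmul' k (S := k)).toLinearMap ∘ₗ
      (toConv (TensorProduct.map f.ofConv (1 : WithConv (Y →ₗ[k] k)).ofConv)).ofConv) := by
    apply WithConv.ext
    apply TensorProduct.ext'
    intro x y
    change f.ofConv (Coalgebra.counit (R := k) y • x) = f.ofConv x * Coalgebra.counit (R := k) y
    rw [map_smul, smul_eq_mul, mul_comm]
  have hg : pull k (projA k X Y) g = toConv ((Algebra.TensorProduct.lmul' k (S := k)).toLinearMap ∘ₗ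
      (toConv (TensorProduct.map (1 : WithConv (X →ₗ[k] k)).ofConv g.ofConv)).ofConv) := by
    apply WithConv.ext
    apply TensorProduct.ext'
    intro x y
    change g.ofConv (Coalgebra.counit (R := k) x • y) = Coalgebra.counit (R := k) x * g.ofConv y
    rw [map_smul, smul_eq_mul]
  rw [hf, hg]
  have e1 := LinearMap.algHom_comp_convMul_distrib (Algebra.TensorProduct.lmul' k (S := k))
    (toConv (TensorProduct.map f.ofConv (1 : WithConv (Y →ₗ[k] k)).ofConv))
    (toConv (TensorProduct.map (1 : WithConv (X →ₗ[k] k)).ofConv g.ofConv))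
  have e2 := LinearMap.algHom_comp_convMul_distrib (Algebra.TensorProduct.lmul' k (S := k))
    (toConv (TensorProduct.map (1 : WithConv (X →ₗ[k] k)).ofConv g.ofConv))
    (toConv (TensorProduct.map f.ofConv (1 : WithConv (Y →ₗ[k] k)).ofConv))
  rw [TensorProduct.map_convMul_map, one_mul, mul_one] at e1 e2
  exact congrArg toConv (e1.symm.trans e2)

variable (k U A) in
/-- The coalgebra map `x ⊗ y ⊗ z ↦ ε(y) x ⊗ z`. -/
def p13 : ((U ⊗[k] A) ⊗[k] (U ⊗[k] A)) ⊗[k] (U ⊗[k] A) →ₗc[k] (U ⊗[k] A) ⊗[k] (U ⊗[k] A) :=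
  Coalgebra.TensorProduct.map (projU k (U ⊗[k] A) (U ⊗[k] A)) (CoalgHom.id k _)

theorem p13_tmul (u v w : U) (a b c : A) :
    p13 k U A (((u ⊗ₜ a) ⊗ₜ (v ⊗ₜ b)) ⊗ₜ (w ⊗ₜ c)) =
      (Coalgebra.counit (R := k) b * Coalgebra.counit (R := k) v) •
        ((u ⊗ₜ a) ⊗ₜ[k] (w ⊗ₜ c)) := rfl

variable (k U A) in
/-- The coalgebra map `(u ⊗ a) ⊗ (v ⊗ b) ⊗ (w ⊗ c) ↦ ε(u) ε(v) ε(c) (a ⊗ b) ⊗ w`. -/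
def qA : ((U ⊗[k] A) ⊗[k] (U ⊗[k] A)) ⊗[k] (U ⊗[k] A) →ₗc[k] (A ⊗[k] A) ⊗[k] U :=
  Coalgebra.TensorProduct.map
    (Coalgebra.TensorProduct.map (projA k U A) (projA k U A)) (projU k U A)

variable (k U A) in
/-- The coalgebra map `(u ⊗ a) ⊗ (v ⊗ b) ⊗ (w ⊗ c) ↦ ε(u) ε(b) ε(c) a ⊗ (v ⊗ w)`. -/
def qU : ((U ⊗[k] A) ⊗[k] (U ⊗[k] A)) ⊗[k] (U ⊗[k] A) →ₗc[k] A ⊗[k] (U ⊗[k] U) :=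
  (Coalgebra.TensorProduct.map (projA k U A)
    (Coalgebra.TensorProduct.map (projU k U A) (projU k U A))).comp
    (Coalgebra.TensorProduct.assoc k k (U ⊗[k] A) (U ⊗[k] A) (U ⊗[k] A)).toCoalgHom

variable (k U A) in
/-- The coalgebra map `(u ⊗ a) ⊗ (v ⊗ b) ⊗ (w ⊗ c) ↦ ε(u) ε(c) (a ⊗ v) ⊗ (b ⊗ w)`. -/
def qM : ((U ⊗[k] A) ⊗[k] (U ⊗[k] A)) ⊗[k] (U ⊗[k] A) →ₗc[k] (A ⊗[k] U) ⊗[k] (A ⊗[k] U) :=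
  ((Coalgebra.TensorProduct.assoc k k (A ⊗[k] U) A U).toCoalgHom.comp
    (Coalgebra.TensorProduct.map (Coalgebra.TensorProduct.assoc k k A U A).symm.toCoalgHom
      (CoalgHom.id k U))).comp
  (Coalgebra.TensorProduct.map
    (Coalgebra.TensorProduct.map (projA k U A) (CoalgHom.id k _)) (projU k U A))

/-- Two linear maps on `(U ⊗ A) ⊗ (U ⊗ A) ⊗ (U ⊗ A)` agree if they agree on pure tensors. -/
theorem ext_six {M : Type*} [AddCommGroup M] [Module k M]
    {f g : ((U ⊗[k] A) ⊗[k] (U ⊗[k] A)) ⊗[k] (U ⊗[k] A) →ₗ[k] M}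
    (h : ∀ (u : U) (a : A) (v : U) (b : A) (w : U) (c : A),
      f (((u ⊗ₜ a) ⊗ₜ (v ⊗ₜ b)) ⊗ₜ (w ⊗ₜ c)) = g (((u ⊗ₜ a) ⊗ₜ (v ⊗ₜ b)) ⊗ₜ (w ⊗ₜ c))) :
    f = g := by
  apply TensorProduct.ext_threefold
  intro x y z
  induction x with
  | zero => simp only [TensorProduct.zero_tmul, map_zero]
  | add x₁ x₂ h₁ h₂ => simp only [TensorProduct.add_tmul, map_add, h₁, h₂]
  | tmul u a =>
    induction y with
    | zero => simp only [TensorProduct.zero_tmul, TensorProduct.tmul_zero, map_zero]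
    | add x₁ x₂ h₁ h₂ =>
      simp only [TensorProduct.add_tmul, TensorProduct.tmul_add, map_add, h₁, h₂]
    | tmul v b =>
      induction z with
      | zero => simp only [TensorProduct.tmul_zero, map_zero]
      | add x₁ x₂ h₁ h₂ => simp only [TensorProduct.tmul_add, map_add, h₁, h₂]
      | tmul w c => exact h u a v b w c

theorem qA_tmul (u v w : U) (a b c : A) :
    qA k U A (((u ⊗ₜ a) ⊗ₜ (v ⊗ₜ b)) ⊗ₜ (w ⊗ₜ c)) =
      ((Coalgebra.counit (R := k) u • a) ⊗ₜ (Coalgebra.counit (R := k) v • b)) ⊗ₜ[k]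
        (Coalgebra.counit (R := k) c • w) := rfl

theorem qU_tmul (u v w : U) (a b c : A) :
    qU k U A (((u ⊗ₜ a) ⊗ₜ (v ⊗ₜ b)) ⊗ₜ (w ⊗ₜ c)) =
      (Coalgebra.counit (R := k) u • a) ⊗ₜ[k]
        ((Coalgebra.counit (R := k) b • v) ⊗ₜ (Coalgebra.counit (R := k) c • w)) := rfl

theorem m12_tmul (x y z : U ⊗[k] A) :
    m12 k (U ⊗[k] A) ((x ⊗ₜ y) ⊗ₜ z) = (x * y) ⊗ₜ z := rfl

theorem m23_tmul (x y z : U ⊗[k] A) :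
    m23 k (U ⊗[k] A) ((x ⊗ₜ y) ⊗ₜ z) = x ⊗ₜ (y * z) := rfl

theorem p12_tmul (u v w : U) (a b c : A) :
    p12 k (U ⊗[k] A) (((u ⊗ₜ a) ⊗ₜ (v ⊗ₜ b)) ⊗ₜ (w ⊗ₜ c)) =
      (Coalgebra.counit (R := k) c * Coalgebra.counit (R := k) w) •
        ((u ⊗ₜ a) ⊗ₜ[k] (v ⊗ₜ b)) := rfl

theorem p23_tmul (u v w : U) (a b c : A) :
    p23 k (U ⊗[k] A) (((u ⊗ₜ a) ⊗ₜ (v ⊗ₜ b)) ⊗ₜ (w ⊗ₜ c)) =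
      (Coalgebra.counit (R := k) a * Coalgebra.counit (R := k) u) •
        ((v ⊗ₜ b) ⊗ₜ[k] (w ⊗ₜ c)) := rfl

theorem pull_apply {C D E : Type*} [AddCommGroup C] [Module k C] [Coalgebra k C]
    [AddCommGroup D] [Module k D] [Coalgebra k D] [Ring E] [Algebra k E] (h : C →ₗc[k] D)
    (f : WithConv (D →ₗ[k] E)) (c : C) : (pull E h f).ofConv c = f.ofConv (h c) := rfl

theorem map_tmul' {X Y Z W : Type*} [Ring X] [Bialgebra k X] [Ring Y] [Bialgebra k Y]
    [Ring Z] [Bialgebra k Z] [Ring W] [Bialgebra k W] (f : X →ₗc[k] Y) (g : Z →ₗc[k] W)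
    (x : X) (z : Z) : Coalgebra.TensorProduct.map f g (x ⊗ₜ z) = f x ⊗ₜ[k] g z := rfl

theorem projA_tmul {X Y : Type*} [Ring X] [Bialgebra k X] [Ring Y] [Bialgebra k Y]
    (x : X) (y : Y) : projA k X Y (x ⊗ₜ y) = Coalgebra.counit (R := k) x • y := rfl

theorem projU_tmul {X Y : Type*} [Ring X] [Bialgebra k X] [Ring Y] [Bialgebra k Y]
    (x : X) (y : Y) : projU k X Y (x ⊗ₜ y) = Coalgebra.counit (R := k) y • x := rfl

theorem pull_m12 (τ : SkewPairing k U A) :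
    pull k (m12 k (U ⊗[k] A)) τ.sigma.val =
      pull k (p23 k (U ⊗[k] A)) τ.sigma.val * pull k (p13 k U A) τ.sigma.val := by
  have e := congrArg
    (pull (C := ((U ⊗[k] A) ⊗[k] (U ⊗[k] A)) ⊗[k] (U ⊗[k] A)) k (qA k U A)) τ.pull_mul_right
  rw [map_mul] at e
  refine Eq.trans ?_ (e.trans (congrArg₂ (· * ·) ?_ ?_))
  · apply WithConv.ext
    apply ext_six
    intro u a v b w c
    rw [pull_apply, pull_apply, pull_apply, m12_tmul, qA_tmul, map_tmul',
      Bialgebra.coe_mulCoalgHom, LinearMap.mul'_apply, CoalgHom.id_apply, flipForm_tmul,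
      Algebra.TensorProduct.tmul_mul_tmul, sigma_tmul, Bialgebra.counit_mul, smul_mul_smul_comm]
    simp only [map_smul, ← TensorProduct.smul_tmul', TensorProduct.tmul_smul, smul_eq_mul]
    ring
  · apply WithConv.ext
    apply ext_six
    intro u a v b w c
    rw [pull_apply, pull_apply, pull_apply, p23_tmul, qA_tmul, map_tmul', projA_tmul,
      CoalgHom.id_apply, flipForm_tmul, LinearMap.map_smul τ.sigma.val.ofConv, sigma_tmul]
    simp only [map_smul, ← TensorProduct.smul_tmul', TensorProduct.tmul_smul, smul_eq_mul]
    ring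
  · apply WithConv.ext
    apply ext_six
    intro u a v b w c
    rw [pull_apply, pull_apply, pull_apply, p13_tmul, qA_tmul, map_tmul', projU_tmul,
      CoalgHom.id_apply, flipForm_tmul, LinearMap.map_smul τ.sigma.val.ofConv, sigma_tmul]
    simp only [map_smul, ← TensorProduct.smul_tmul', TensorProduct.tmul_smul, smul_eq_mul]
    ring

theorem pull_m23 (τ : SkewPairing k U A) :
    pull k (m23 k (U ⊗[k] A)) τ.sigma.val =
      pull k (p12 k (U ⊗[k] A)) τ.sigma.val * pull k (p13 k U A) τ.sigma.val := by
  have e := congrArg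
    (pull (C := ((U ⊗[k] A) ⊗[k] (U ⊗[k] A)) ⊗[k] (U ⊗[k] A)) k (qU k U A)) τ.pull_mul_left
  rw [map_mul] at e
  refine Eq.trans ?_ (e.trans (congrArg₂ (· * ·) ?_ ?_))
  · apply WithConv.ext
    apply ext_six
    intro u a v b w c
    rw [pull_apply, pull_apply, pull_apply, m23_tmul, qU_tmul, map_tmul',
      Bialgebra.coe_mulCoalgHom, LinearMap.mul'_apply, CoalgHom.id_apply, flipForm_tmul,
      Algebra.TensorProduct.tmul_mul_tmul, sigma_tmul, Bialgebra.counit_mul, smul_mul_smul_comm]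
    simp only [map_smul, ← TensorProduct.smul_tmul', TensorProduct.tmul_smul, smul_eq_mul]
    ring
  · apply WithConv.ext
    apply ext_six
    intro u a v b w c
    rw [pull_apply, pull_apply, pull_apply, p12_tmul, qU_tmul, map_tmul', projU_tmul,
      CoalgHom.id_apply, flipForm_tmul, LinearMap.map_smul τ.sigma.val.ofConv, sigma_tmul]
    simp only [map_smul, ← TensorProduct.smul_tmul', TensorProduct.tmul_smul, smul_eq_mul]
    ring
  · apply WithConv.ext
    apply ext_six
    intro u a v b w c
    rw [pull_apply, pull_apply, pull_apply, p13_tmul, qU_tmul, map_tmul', projA_tmul,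
      CoalgHom.id_apply, flipForm_tmul, LinearMap.map_smul τ.sigma.val.ofConv, sigma_tmul]
    simp only [map_smul, ← TensorProduct.smul_tmul', TensorProduct.tmul_smul, smul_eq_mul]
    ring

theorem pull_p12_comm (τ : SkewPairing k U A) :
    pull k (p12 k (U ⊗[k] A)) τ.sigma.val * pull k (p23 k (U ⊗[k] A)) τ.sigma.val =
      pull k (p23 k (U ⊗[k] A)) τ.sigma.val * pull k (p12 k (U ⊗[k] A)) τ.sigma.val := by
  have e := congrArg
    (pull (C := ((U ⊗[k] A) ⊗[k] (U ⊗[k] A)) ⊗[k] (U ⊗[k] A)) k (qM k U A)) (pull_comm τ.flipForm τ.flipForm)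
  rw [map_mul, map_mul] at e
  have h12 : pull k (qM k U A) (pull k (projU k (A ⊗[k] U) (A ⊗[k] U)) τ.flipForm) =
      pull k (p12 k (U ⊗[k] A)) τ.sigma.val := by
    apply WithConv.ext
    apply ext_six
    intro u a v b w c
    change τ.flipForm.ofConv ((Coalgebra.counit (R := k) (Coalgebra.counit (R := k) c • w) •
        Coalgebra.counit (R := k) b) • ((Coalgebra.counit (R := k) u • a) ⊗ₜ v)) =
      τ.form (proj k U A ((Coalgebra.counit (R := k) c • Coalgebra.counit (R := k) w) •
        ((u ⊗ₜ a) ⊗ₜ (v ⊗ₜ b))))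
    rw [map_smul (proj k U A), proj_tmul, map_smul, flipForm_tmul]
    simp only [map_smul, ← TensorProduct.smul_tmul', smul_eq_mul]
    ring
  have h23 : pull k (qM k U A) (pull k (projA k (A ⊗[k] U) (A ⊗[k] U)) τ.flipForm) =
      pull k (p23 k (U ⊗[k] A)) τ.sigma.val := by
    apply WithConv.ext
    apply ext_six
    intro u a v b w c
    change τ.flipForm.ofConv ((Coalgebra.counit (R := k) v • Coalgebra.counit (R := k)
        (Coalgebra.counit (R := k) u • a)) • (b ⊗ₜ (Coalgebra.counit (R := k) c • w))) =
      τ.form (proj k U A ((Coalgebra.counit (R := k) a • Coalgebra.counit (R := k) u) •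
        ((v ⊗ₜ b) ⊗ₜ (w ⊗ₜ c))))
    rw [map_smul (proj k U A), proj_tmul, map_smul, flipForm_tmul]
    simp only [map_smul, TensorProduct.tmul_smul, smul_eq_mul]
    ring
  rw [h12, h23] at e
  exact e

/-- The form `σ` is a 2-cocycle for the tensor product bialgebra `U ⊗ A`. -/
theorem sigma_isTwoCocycle (τ : SkewPairing k U A) : IsTwoCocycle τ.sigma.val.ofConv := by
  rw [isTwoCocycle_iff, Units.ext_iff]
  change pull k (p12 k (U ⊗[k] A)) τ.sigma.val * pull k (m12 k (U ⊗[k] A)) τ.sigma.val =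
    pull k (p23 k (U ⊗[k] A)) τ.sigma.val * pull k (m23 k (U ⊗[k] A)) τ.sigma.val
  rw [pull_m12, pull_m23, ← mul_assoc, pull_p12_comm, mul_assoc]

variable (k U A) in
/-- The coalgebra map `u ↦ u ⊗ 1`. -/
def coalgInclU : U →ₗc[k] U ⊗[k] A :=
  (Coalgebra.TensorProduct.map (CoalgHom.id k U)
    ((Bialgebra.unitBialgHom k A : k →ₐc[k] A) : k →ₗc[k] A)).comp
    (Coalgebra.TensorProduct.rid k k U).symm.toCoalgHom

variable (k U A) in
/-- The coalgebra map `a ↦ 1 ⊗ a`. -/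
def coalgInclA : A →ₗc[k] U ⊗[k] A :=
  (Coalgebra.TensorProduct.map ((Bialgebra.unitBialgHom k U : k →ₐc[k] U) : k →ₗc[k] U)
    (CoalgHom.id k A)).comp (Coalgebra.TensorProduct.lid k A).symm.toCoalgHom

theorem twistMul_eq_of_pull_eq_one (τ : SkewPairing k U A) {C : Type*} [AddCommGroup C]
    [Module k C] [Coalgebra k C] (h : C →ₗc[k] (U ⊗[k] A) ⊗[k] (U ⊗[k] A))
    (hh : pull k h τ.sigma.val = 1) (c : C) :
    twistMul τ.sigma (h c) = LinearMap.mul' k (U ⊗[k] A) (h c) := by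
  have h1 : Units.map (pull k h) τ.sigma = 1 := Units.ext hh
  have e := twistMul_comp τ.sigma h
  rw [h1, inv_one, Units.val_one, scal_one, one_mul, mul_one] at e
  exact DFunLike.congr_fun (congrArg WithConv.ofConv e) c

/-- `(u ⊗ 1)(u' ⊗ a') = uu' ⊗ a'` for the twisted multiplication. -/
theorem twistMul_one_right (τ : SkewPairing k U A) (u u' : U) (a' : A) :
    twistMul τ.sigma ((u ⊗ₜ 1) ⊗ₜ (u' ⊗ₜ a')) = (u * u') ⊗ₜ[k] a' := by
  have e := τ.twistMul_eq_of_pull_eq_one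
    (Coalgebra.TensorProduct.map (coalgInclU k U A) (CoalgHom.id k (U ⊗[k] A))) ?_
    (u ⊗ₜ (u' ⊗ₜ a'))
  · have h1 : Coalgebra.TensorProduct.map (coalgInclU k U A) (CoalgHom.id k (U ⊗[k] A))
        (u ⊗ₜ (u' ⊗ₜ a')) = (u ⊗ₜ[k] (1 : A)) ⊗ₜ[k] (u' ⊗ₜ[k] a') := by
      simp [coalgInclU]
    rw [h1] at e
    simpa using e
  · apply WithConv.ext
    apply TensorProduct.ext
    ext v : 1
    apply TensorProduct.ext'
    intro w c
    change τ.sigma.val.ofConv ((v ⊗ₜ algebraMap k A 1) ⊗ₜ (w ⊗ₜ c)) =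
      Coalgebra.counit (R := k) (w ⊗ₜ[k] c) • Coalgebra.counit (R := k) v
    rw [map_one, sigma_tmul, form_one_right, TensorProduct.counit_tmul]
    simp only [smul_eq_mul]
    ring

/-- `(u ⊗ a)(1 ⊗ a') = u ⊗ aa'` for the twisted multiplication. -/
theorem twistMul_one_left (τ : SkewPairing k U A) (u : U) (a a' : A) :
    twistMul τ.sigma ((u ⊗ₜ a) ⊗ₜ (1 ⊗ₜ a')) = u ⊗ₜ[k] (a * a') := by
  have e := τ.twistMul_eq_of_pull_eq_one
    (Coalgebra.TensorProduct.map (CoalgHom.id k (U ⊗[k] A)) (coalgInclA k U A)) ?_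
    ((u ⊗ₜ a) ⊗ₜ a')
  · have h1 : Coalgebra.TensorProduct.map (CoalgHom.id k (U ⊗[k] A)) (coalgInclA k U A)
        ((u ⊗ₜ a) ⊗ₜ a') = (u ⊗ₜ[k] a) ⊗ₜ[k] ((1 : U) ⊗ₜ[k] a') := by
      simp [coalgInclA]
    rw [h1] at e
    simpa using e
  · apply WithConv.ext
    apply TensorProduct.ext_threefold
    intro v b c
    change τ.sigma.val.ofConv ((v ⊗ₜ b) ⊗ₜ (algebraMap k U 1 ⊗ₜ c)) =
      Coalgebra.counit (R := k) c • Coalgebra.counit (R := k) (v ⊗ₜ[k] b)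
    rw [map_one, sigma_tmul, form_one_left, TensorProduct.counit_tmul]
    simp only [smul_eq_mul]
    ring

/-- The algebra `H = (U ⊗ A)^σ`: the vector space `U ⊗ A` with the multiplication of the tensor
product bialgebra twisted by the 2-cocycle `σ`. -/
def H (_τ : SkewPairing k U A) : Type _ := U ⊗[k] A

variable (τ : SkewPairing k U A)

instance instAddCommGroup : AddCommGroup τ.H :=
  (TensorProduct.addCommGroup : AddCommGroup (U ⊗[k] A))

instance instModule : Module k τ.H := (TensorProduct.instModule : Module k (U ⊗[k] A))

/-- The element `u ⊗ a` of `H`. -/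
def tmul (u : U) (a : A) : τ.H := (u ⊗ₜ[k] a : U ⊗[k] A)

theorem tmul_induction {p : τ.H → Prop} (x : τ.H) (h0 : p 0) (ht : ∀ u a, p (τ.tmul u a))
    (ha : ∀ x y, p x → p y → p (x + y)) : p x :=
  TensorProduct.induction_on (motive := p) x h0 ht ha

/-- The multiplication of `H` as a bilinear map. -/
def mulH : τ.H →ₗ[k] τ.H →ₗ[k] τ.H :=
  TensorProduct.curry (R := k) (twistMul τ.sigma : (U ⊗[k] A) ⊗[k] (U ⊗[k] A) →ₗ[k] U ⊗[k] A)

theorem mulH_one_right (u u' : U) (a' : A) :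
    τ.mulH (τ.tmul u 1) (τ.tmul u' a') = τ.tmul (u * u') a' :=
  τ.twistMul_one_right u u' a'

theorem mulH_one_left (u : U) (a a' : A) :
    τ.mulH (τ.tmul u a) (τ.tmul 1 a') = τ.tmul u (a * a') :=
  τ.twistMul_one_left u a a'

instance instRing : Ring τ.H where
  __ := τ.instAddCommGroup
  mul x y := τ.mulH x y
  one := τ.tmul 1 1
  mul_assoc x y z := twistMul_assoc τ.sigma τ.sigma_isTwoCocycle x y z
  one_mul x := by
    change τ.mulH (τ.tmul 1 1) x = x
    refine τ.tmul_induction (p := fun x => τ.mulH (τ.tmul 1 1) x = x) x (map_zero _)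
      (fun u a => ?_) (fun x y hx hy => ?_)
    · rw [mulH_one_right, one_mul]
    · rw [map_add, hx, hy]
  mul_one x := by
    change τ.mulH x (τ.tmul 1 1) = x
    refine τ.tmul_induction (p := fun x => τ.mulH x (τ.tmul 1 1) = x) x ?_
      (fun u a => ?_) (fun x y hx hy => ?_)
    · rw [map_zero, LinearMap.zero_apply]
    · rw [mulH_one_left, mul_one]
    · rw [map_add, LinearMap.add_apply, hx, hy]
  left_distrib x y z := map_add (τ.mulH x) y z
  right_distrib x y z := LinearMap.map_add₂ τ.mulH x y z
  zero_mul x := LinearMap.map_zero₂ τ.mulH x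
  mul_zero x := map_zero (τ.mulH x)

theorem mul_def (x y : τ.H) : x * y = τ.mulH x y := rfl

instance instAlgebra : Algebra k τ.H :=
  Algebra.ofModule (fun r x y => LinearMap.map_smul₂ τ.mulH r x y)
    (fun r x y => map_smul (τ.mulH x) r y)

/-- The algebra map `U → H`, `u ↦ u ⊗ 1`. -/
def inclU : U →ₐ[k] τ.H :=
  AlgHom.ofLinearMap ((TensorProduct.mk k U A).flip 1) rfl
    (fun u u' => (τ.mulH_one_right u u' 1).symm)

/-- The algebra map `A → H`, `a ↦ 1 ⊗ a`. -/
def inclA : A →ₐ[k] τ.H :=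
  AlgHom.ofLinearMap (TensorProduct.mk k U A 1) rfl
    (fun a a' => (τ.mulH_one_left 1 a a').symm)

/-! ### The modules `L(ρ, χ)` -/

/-- The linear map `id ⊗ χ : H → U`, `u ⊗ a ↦ χ(a) u`. -/
def idTensor (χ : A →ₐ[k] k) : τ.H →ₗ[k] U :=
  ((TensorProduct.rid k U).toLinearMap ∘ₗ TensorProduct.map LinearMap.id χ.toLinearMap :
    U ⊗[k] A →ₗ[k] U)

theorem idTensor_tmul (χ : A →ₐ[k] k) (u : U) (a : A) :
    τ.idTensor χ (τ.tmul u a) = χ a • u := rfl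

theorem idTensor_mul_inclA (χ : A →ₐ[k] k) (h : τ.H) (a : A) :
    τ.idTensor χ (h * τ.inclA a) = χ a • τ.idTensor χ h := by
  refine τ.tmul_induction (p := fun h => τ.idTensor χ (h * τ.inclA a) = χ a • τ.idTensor χ h) h
    ?_ (fun u b => ?_) (fun x y hx hy => ?_)
  · rw [zero_mul, map_zero, smul_zero]
  · change τ.idTensor χ (τ.mulH (τ.tmul u b) (τ.tmul 1 a)) = _
    rw [mulH_one_left, idTensor_tmul, idTensor_tmul, map_mul, smul_smul, mul_comm]
  · rw [add_mul, map_add, map_add, hx, hy, smul_add]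

theorem idTensor_mul (χ : A →ₐ[k] k) (h x : τ.H) :
    τ.idTensor χ (h * x) = τ.idTensor χ (h * τ.inclU (τ.idTensor χ x)) := by
  refine τ.tmul_induction
    (p := fun x => τ.idTensor χ (h * x) = τ.idTensor χ (h * τ.inclU (τ.idTensor χ x))) x
    ?_ (fun u a => ?_) (fun x y hx hy => ?_)
  · rw [map_zero, map_zero]
  · have e : τ.tmul u a = τ.inclU u * τ.inclA a := by
      change _ = τ.mulH (τ.tmul u 1) (τ.tmul 1 a)
      rw [mulH_one_left, one_mul]
    rw [idTensor_tmul, e, ← mul_assoc, idTensor_mul_inclA, map_smul τ.inclU, mul_smul_comm,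
      map_smul]
  · rw [mul_add, map_add, hx, hy, map_add (τ.idTensor χ) x y, map_add τ.inclU, mul_add, map_add]

/-- The left `H`-module `U_χ`, i.e. `H ⊗_A k_χ` identified with the vector space `U` via
`(u ⊗ a) ⊗_A 1 ↦ χ(a) u`; the action is `h · u' = (id ⊗ χ)(h (u' ⊗ 1))`. -/
def Ind (_τ : SkewPairing k U A) (_χ : A →ₐ[k] k) : Type _ := U

instance instAddCommGroupInd (χ : A →ₐ[k] k) : AddCommGroup (τ.Ind χ) :=
  (Ring.toAddCommGroup : AddCommGroup U)

/-- The identification of the vector spaces `U` and `U_χ`. -/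
def toInd (χ : A →ₐ[k] k) : U ≃+ τ.Ind χ := AddEquiv.refl U

instance instModuleInd (χ : A →ₐ[k] k) : Module τ.H (τ.Ind χ) where
  smul h u := τ.toInd χ (τ.idTensor χ (h * τ.inclU ((τ.toInd χ).symm u)))
  one_smul u := by
    change τ.idTensor χ (1 * τ.inclU u) = u
    rw [one_mul]
    change χ 1 • (τ.toInd χ).symm u = (τ.toInd χ).symm u
    rw [map_one, one_smul]
  mul_smul h h' u := by
    change τ.idTensor χ (h * h' * τ.inclU u) =
      τ.idTensor χ (h * τ.inclU (τ.idTensor χ (h' * τ.inclU u)))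
    rw [mul_assoc, idTensor_mul]
  smul_zero h := by
    change τ.idTensor χ (h * τ.inclU 0) = 0
    rw [map_zero, mul_zero, map_zero]
  smul_add h u v := by
    change τ.idTensor χ (h * τ.inclU ((τ.toInd χ).symm (u + v))) =
      τ.idTensor χ (h * τ.inclU ((τ.toInd χ).symm u)) +
        τ.idTensor χ (h * τ.inclU ((τ.toInd χ).symm v))
    rw [map_add, map_add, mul_add, map_add]
  add_smul h h' u := by
    change τ.idTensor χ ((h + h') * τ.inclU u) =
      τ.idTensor χ (h * τ.inclU u) + τ.idTensor χ (h' * τ.inclU u)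
    rw [add_mul, map_add]
  zero_smul u := by
    change τ.idTensor χ (0 * τ.inclU u) = 0
    rw [zero_mul, map_zero]

/-- `(u ⊗ a) · u' = u (id ⊗ χ)((1 ⊗ a)(u' ⊗ 1))`. -/
theorem tmul_smul_toInd (χ : A →ₐ[k] k) (u u' : U) (a : A) :
    τ.tmul u a • τ.toInd χ u' = τ.toInd χ (u * τ.idTensor χ (τ.tmul 1 a * τ.tmul u' 1)) := by
  change τ.idTensor χ (τ.tmul u a * τ.tmul u' 1) = u * τ.idTensor χ (τ.tmul 1 a * τ.tmul u' 1)
  have e : τ.tmul u a = τ.tmul u 1 * τ.tmul 1 a := by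
    rw [mul_def, mulH_one_left, one_mul]
  rw [e, mul_assoc]
  generalize τ.tmul 1 a * τ.tmul u' 1 = x
  refine τ.tmul_induction
    (p := fun x => τ.idTensor χ (τ.tmul u 1 * x) = u * τ.idTensor χ x) x
    ?_ (fun v b => ?_) (fun x y hx hy => ?_)
  · rw [mul_zero, map_zero, mul_zero]
  · rw [mul_def, mulH_one_right, idTensor_tmul, idTensor_tmul, mul_smul_comm]
  · rw [mul_add, map_add, map_add, hx, hy, mul_add]

/-- `I(ρ, χ)`: the sum of all `H`-submodules of `U_χ` contained in `Ker ρ`. -/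
def maxSub (ρ : U →ₐ[k] k) (χ : A →ₐ[k] k) : Submodule τ.H (τ.Ind χ) :=
  sSup {W | ∀ x ∈ W, ρ ((τ.toInd χ).symm x) = 0}

/-- `L(ρ, χ) = U_χ / I(ρ, χ)`. -/
abbrev L (ρ : U →ₐ[k] k) (χ : A →ₐ[k] k) : Type _ := τ.Ind χ ⧸ τ.maxSub ρ χ

/-! ### The category `ₕM` -/

section Objects

variable {M : Type*} [AddCommGroup M] [Module k M] [Module τ.H M] [IsScalarTower k τ.H M]

/-- A subspace of an `H`-module is an `A`-submodule. -/
def IsASubmodule (V : Submodule k M) : Prop := ∀ (a : A), ∀ m ∈ V, τ.inclA a • m ∈ V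

/-- A subspace of an `H`-module is a `U`-submodule. -/
def IsUSubmodule (V : Submodule k M) : Prop := ∀ (u : U), ∀ m ∈ V, τ.inclU u • m ∈ V

variable (M) in
/-- The `H`-module `M` is an object of `ₕM`: it is generated by a one-dimensional
`A`-submodule and has a codimension one `U`-submodule containing no nonzero `H`-submodule. -/
structure IsObject : Prop where
  exists_line : ∃ V : Submodule k M, τ.IsASubmodule V ∧ Module.finrank k V = 1 ∧
    Submodule.span τ.H (V : Set M) = ⊤
  exists_hyperplane : ∃ N : Submodule k M, τ.IsUSubmodule N ∧ Module.finrank k (M ⧸ N) = 1 ∧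
    ∀ W : Submodule τ.H M, (W : Set M) ⊆ N → W = ⊥

end Objects

open scoped ModuleCat in
/-- The objects of `ₕM` among all left `H`-modules. -/
def objectProperty : CategoryTheory.ObjectProperty (ModuleCat.{w} τ.H) :=
  fun M => τ.IsObject M

/-- The category `ₕM`, a full subcategory of the category of left `H`-modules. -/
abbrev Cat := (objectProperty.{w} τ).FullSubcategory

/-- The set `[ₕM]` of isomorphism classes of objects of `ₕM`. -/
abbrev IsoClasses := Quotient (CategoryTheory.isIsomorphicSetoid (Cat.{w} τ))

end SkewPairing

/-- All finite-dimensional irreducible left modules over the `k`-algebra `R` are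
one-dimensional. (Irreducible modules are cyclic, so those in the universe of `R` suffice.) -/
def FiniteDimensionalIrreduciblesAreLines (k : Type*) [Field k] (R : Type w) [Ring R]
    [Algebra k R] : Prop :=
  ∀ (V : Type w) [AddCommGroup V] [Module k V] [Module R V] [IsScalarTower k R V]
    [FiniteDimensional k V] [IsSimpleModule R V], Module.finrank k V = 1

end

/-!
A character `ψ` of a pointed Hopf algebra which is `1` on group-likes kills every skew primitive
element `a` of finite type. After multiplying by a group-like, `Δ(a) = a ⊗ g + 1 ⊗ a`, so the
endomorphism `x ↦ x₍₁₎ ψ(x₍₂₎)` fixes the coradical and sends `a` to `a + ψ(a)`. It therefore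
maps a monic relation for `a` over the coradical to a relation for `a + ψ(a)`, and taking
differences lowers the degree until only a nonzero multiple of a power of `ψ(a)` remains. Hence
the characters of `U` and of `A` are determined by their values on group-likes, and they commute
for convolution.

An object `M` of `ₕM` carries a generator `m` of some weight `χ` and a functional `f` of some
weight `ρ` whose kernel contains no nonzero `H`-submodule, so that `u ↦ u m` induces
`M ≅ L(ρ, χ)`. Multiplying by a group-like in `H` conjugates by a character that `τ` pairs with
it. As characters commute, group-likes of `A` act on `f` through `χ`, and those of `U` act on
`m` through `ρ`. So every weight vector of `M` has weight `χ` and every weight functional has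
weight `ρ`, and both are unique up to scalars.
-/

noncomputable section

namespace HopfSub

open WithConv Polynomial

section GroupLike

variable {k C : Type*} [Field k] [AddCommGroup C] [Module k C] [Coalgebra k C]

theorem isSubcoalgebra_span_singleton {g : C} (hg : IsGroupLikeElem k g) :
    IsSubcoalgebra k (k ∙ g) := by
  intro c hc
  obtain ⟨r, rfl⟩ := Submodule.mem_span_singleton.1 hc
  rw [map_smul, hg.comul_eq_tmul_self, TensorProduct.range_mapIncl]
  exact Submodule.smul_mem _ _ (Submodule.apply_mem_map₂ _ (Submodule.mem_span_singleton_self g)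
    (Submodule.mem_span_singleton_self g))

theorem mem_coradical_of_isGroupLikeElem {g : C} (hg : IsGroupLikeElem k g) :
    g ∈ coradical k C := by
  have hatom : IsAtom (k ∙ g) := nonzero_span_atom g hg.ne_zero
  have hsimple : IsSimpleSubcoalgebra k (k ∙ g) :=
    ⟨isSubcoalgebra_span_singleton hg, hatom.1, fun D _ hD => hatom.le_iff.1 hD⟩
  exact (le_sSup hsimple : (k ∙ g) ≤ coradical k C) (Submodule.mem_span_singleton_self g)

theorem IsSubcoalgebra.exists_comul_eq_smul {c : C} (h : IsSubcoalgebra k (k ∙ c)) :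
    ∃ r : k, Coalgebra.comul (R := k) c = r • (c ⊗ₜ[k] c) := by
  have hc := h c (Submodule.mem_span_singleton_self c)
  rw [TensorProduct.range_mapIncl, Submodule.map₂_span_singleton_eq_map,
    LinearMap.map_span, Set.image_singleton, Submodule.mem_span_singleton] at hc
  exact hc.imp fun _ => Eq.symm

theorem mul_counit_eq_one_of_comul_eq_smul {c : C} (hc : c ≠ 0) {r : k}
    (h : Coalgebra.comul (R := k) c = r • (c ⊗ₜ[k] c)) : r * Coalgebra.counit (R := k) c = 1 := by
  have hcounit : (r * Coalgebra.counit (R := k) c) • c = (1 : k) • c := by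
    have := congrArg (TensorProduct.lid k C) (Coalgebra.rTensor_counit_comul (R := k) c)
    simpa [h, smul_smul] using this
  exact smul_left_injective k hc hcounit

/-- The coalgebra structure of a line `k ∙ c` is `Δ c = r (c ⊗ c)`, and `r c` is group-like. -/
theorem IsSubcoalgebra.exists_eq_span_isGroupLikeElem {D : Submodule k C}
    (hD : IsSubcoalgebra k D) (h1 : Module.finrank k D = 1) :
    ∃ g, IsGroupLikeElem k g ∧ D = k ∙ g := by
  obtain ⟨⟨c, hcD⟩, hc0, -⟩ := finrank_eq_one_iff'.1 h1
  have hc : c ≠ 0 := fun h => hc0 (Subtype.ext h)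
  obtain rfl := eq_span_singleton_of_mem_of_finrank_eq_one h1 hcD hc
  obtain ⟨r, hr⟩ := hD.exists_comul_eq_smul
  have hunit := mul_counit_eq_one_of_comul_eq_smul hc hr
  refine ⟨r • c, ⟨by rw [map_smul, smul_eq_mul, hunit], ?_⟩,
    (Submodule.span_singleton_smul_eq (IsUnit.of_mul_eq_one _ hunit) c).symm⟩
  rw [map_smul, hr, TensorProduct.smul_tmul_smul, smul_smul]

theorem IsPointed.coradical_eq_span (h : IsPointed k C) :
    coradical k C = Submodule.span k {g | IsGroupLikeElem k g} := by
  refine le_antisymm (sSup_le fun D hD => ?_)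
    (Submodule.span_le.2 fun g hg => mem_coradical_of_isGroupLikeElem hg)
  obtain ⟨g, hg, rfl⟩ := hD.isSubcoalgebra.exists_eq_span_isGroupLikeElem (h D hD)
  exact Submodule.span_mono (Set.singleton_subset_iff.2 hg)

end GroupLike

section Shift

variable {R M N : Type*} [CommRing R] [AddCommGroup M] [Module R M] [AddCommGroup N] [Module R N]

theorem natDegree_taylor_sub_le {p : R[X]} {n : ℕ} (hp : p.natDegree ≤ n + 1) (s : R) :
    (taylor s p - p).natDegree ≤ n := by
  rw [natDegree_le_iff_coeff_eq_zero]
  intro j hj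
  have hderiv : (hasseDeriv j p).natDegree ≤ 0 := (natDegree_hasseDeriv_le p j).trans (by omega)
  rw [coeff_sub, taylor_coeff, eq_C_of_natDegree_le_zero hderiv, eval_C, hasseDeriv_coeff,
    zero_add, Nat.choose_self, Nat.cast_one, one_mul, sub_self]

theorem coeff_taylor_sub {p : R[X]} {n : ℕ} (hp : p.natDegree ≤ n + 1) (s : R) :
    (taylor s p - p).coeff n = (n + 1) * p.coeff (n + 1) * s := by
  have hderiv : (hasseDeriv n p).natDegree < 2 :=
    lt_of_le_of_lt (natDegree_hasseDeriv_le p n) (by omega)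
  rw [coeff_sub, taylor_coeff, eval_eq_sum_range' hderiv, Finset.sum_range_succ,
    Finset.sum_range_one, hasseDeriv_coeff, hasseDeriv_coeff]
  simp [add_comm 1 n, Nat.choose_succ_self_right]

theorem apply_aeval_of_intertwines {β : M →ₗ[R] N} {f : Module.End R M} {g : Module.End R N}
    (h : ∀ x, β (f x) = g (β x)) (p : R[X]) (x : M) : β (aeval f p x) = aeval g p (β x) := by
  induction p using Polynomial.induction_on generalizing x with
  | C r => simp only [aeval_C, Module.algebraMap_end_apply, map_smul]
  | add p q hp hq => simp only [map_add, LinearMap.add_apply, hp, hq]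
  | monomial n r ih =>
    rw [pow_succ, ← mul_assoc, map_mul (aeval f), map_mul (aeval g), aeval_X, aeval_X,
      Module.End.mul_apply, Module.End.mul_apply, ih, h]

/-- If `p` annihilates `x` then so does `p(T + s) - p(T)`, whose degree is smaller. -/
theorem factorial_mul_pow_smul_eq_zero {β f : Module.End R M} {s : R}
    (h : ∀ y, β (f y) = (f + algebraMap R (Module.End R M) s) (β y)) {x : M} (hx : β x = x)
    {n : ℕ} {p : R[X]} (hdeg : p.natDegree ≤ n) (hp : aeval f p x = 0) :
    (n.factorial * s ^ n * p.coeff n) • x = 0 := by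
  induction n generalizing p with
  | zero =>
    rw [eq_C_of_natDegree_le_zero hdeg, aeval_C, Module.algebraMap_end_apply] at hp
    simpa using hp
  | succ n ih =>
    have htaylor : aeval f (taylor s p) x = 0 := by
      rw [taylor_apply, aeval_comp, map_add, aeval_X, aeval_C]
      nth_rw 1 [← hx]
      rw [← apply_aeval_of_intertwines h, hp, map_zero]
    have := ih (natDegree_taylor_sub_le hdeg s)
      (by rw [map_sub, LinearMap.sub_apply, htaylor, hp, sub_zero])
    rw [coeff_taylor_sub hdeg] at this
    rw [← this, Nat.factorial_succ, Nat.cast_mul, Nat.cast_succ]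
    congr 1
    ring

theorem exists_monic_aeval_apply_eq_zero {P : Submodule R M} [Module.Finite R P]
    {f : Module.End R M} (hf : ∀ y ∈ P, f y ∈ P) {x : M} (hx : x ∈ P) :
    ∃ p : R[X], p.Monic ∧ aeval f p x = 0 := by
  obtain ⟨p, hmonic, hp⟩ := LinearMap.exists_monic_and_aeval_eq_zero _ (f.restrict hf)
  have hrestrict := apply_aeval_of_intertwines (β := P.subtype) (f := f.restrict hf) (g := f)
    (fun _ => rfl) p ⟨x, hx⟩
  rw [hp] at hrestrict
  exact ⟨p, hmonic, hrestrict.symm⟩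

theorem exists_factorial_mul_pow_smul_eq_zero {β f : Module.End R M} {s : R}
    (h : ∀ y, β (f y) = (f + algebraMap R (Module.End R M) s) (β y)) {x : M} (hx : β x = x)
    {P : Submodule R M} [Module.Finite R P] (hf : ∀ y ∈ P, f y ∈ P) (hxP : x ∈ P) :
    ∃ n : ℕ, (n.factorial * s ^ n : R) • x = 0 := by
  obtain ⟨p, hmonic, hp⟩ := exists_monic_aeval_apply_eq_zero hf hxP
  have := factorial_mul_pow_smul_eq_zero h hx le_rfl hp
  rw [hmonic.coeff_natDegree, mul_one] at this
  exact ⟨_, this⟩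

end Shift

section Bialgebra

variable {k B : Type*} [Field k] [Ring B] [Bialgebra k B]

/-- The algebra endomorphism `x ↦ x₍₁₎ ψ(x₍₂₎)` given by a character `ψ`. -/
def translate (ψ : B →ₐ[k] k) : B →ₐ[k] B :=
  (Algebra.TensorProduct.rid k k B).toAlgHom.comp
    ((Algebra.TensorProduct.map (AlgHom.id k B) ψ).comp (Bialgebra.comulAlgHom k B))

theorem translate_of_isGroupLikeElem (ψ : B →ₐ[k] k) {g : B} (hg : IsGroupLikeElem k g) :
    translate ψ g = ψ g • g := by
  simp [translate, hg.comul_eq_tmul_self]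

theorem translate_of_comul_eq (ψ : B →ₐ[k] k) {a g : B}
    (ha : Coalgebra.comul (R := k) a = a ⊗ₜ[k] g + 1 ⊗ₜ[k] a) :
    translate ψ a = ψ g • a + algebraMap k B (ψ a) := by
  simp [translate, ha, Algebra.algebraMap_eq_smul_one]

open scoped IsMulCommutative in
/-- Translation by `ψ` turns right multiplication by `a` into right multiplication by
`a + ψ(a)`, while a monic polynomial in `a` annihilates `1`. -/
theorem apply_eq_zero_of_comul_eq [CharZero k] {R : Subalgebra k B} [IsMulCommutative R]
    {ψ : B →ₐ[k] k} (hψR : ∀ r ∈ R, translate ψ r = r) {P : Submodule R B} [Module.Finite R P]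
    (hP : (1 : B) ∈ P) {a g : B} (hmul : ∀ x ∈ P, x * a ∈ P) (hψg : ψ g = 1)
    (ha : Coalgebra.comul (R := k) a = a ⊗ₜ[k] g + 1 ⊗ₜ[k] a) : ψ a = 0 := by
  let β : Module.End R B :=
    { toFun := translate ψ
      map_add' := map_add _
      map_smul' := fun r x => (map_mul (translate ψ) _ _).trans (by rw [hψR r r.2]; rfl) }
  have hβ : ∀ x, β (LinearMap.mulRight R a x) = (LinearMap.mulRight R a +
      algebraMap R (Module.End R B) (algebraMap k R (ψ a))) (β x) := by
    intro x
    change translate ψ (x * a) = translate ψ x * a + algebraMap k B (ψ a) * translate ψ x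
    rw [map_mul, translate_of_comul_eq ψ ha, hψg, one_smul, mul_add, Algebra.commutes]
  obtain ⟨n, hn⟩ := exists_factorial_mul_pow_smul_eq_zero hβ (map_one (translate ψ)) hmul hP
  have hcounit := congrArg (Coalgebra.counit (R := k)) hn
  rw [← map_pow, ← map_natCast (algebraMap k R), ← map_mul, algebraMap_smul, map_smul,
    Bialgebra.counit_one, map_zero, smul_eq_mul, mul_one] at hcounit
  exact eq_zero_of_pow_eq_zero
    ((mul_eq_zero.1 hcounit).resolve_left (Nat.cast_ne_zero.2 n.factorial_ne_zero))

theorem conv_apply_of_isGroupLikeElem (χ χ' : WithConv (B →ₐ[k] k)) {g : B}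
    (hg : IsGroupLikeElem k g) : (χ * χ').ofConv g = χ.ofConv g * χ'.ofConv g := by
  have := AlgHom.convMul_apply χ χ' g
  rw [hg.comul_eq_tmul_self, Algebra.TensorProduct.lift_tmul] at this
  exact this

variable (k B) in
/-- Restriction of characters of `B` to the group-like elements is injective. -/
def GroupLikesDetermineCharacters : Prop :=
  ∀ χ χ' : B →ₐ[k] k, (∀ g, IsGroupLikeElem k g → χ g = χ' g) → χ = χ'

theorem GroupLikesDetermineCharacters.conv_comm (h : GroupLikesDetermineCharacters k B)
    (χ χ' : WithConv (B →ₐ[k] k)) : χ * χ' = χ' * χ := by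
  refine WithConv.ext (h _ _ fun g hg => ?_)
  rw [conv_apply_of_isGroupLikeElem _ _ hg, conv_apply_of_isGroupLikeElem _ _ hg, mul_comm]

theorem GroupLikesDetermineCharacters.commute_toLinearMap (h : GroupLikesDetermineCharacters k B)
    (χ χ' : B →ₐ[k] k) : Commute (toConv χ.toLinearMap) (toConv χ'.toLinearMap) :=
  congrArg (fun ψ : WithConv (B →ₐ[k] k) => toConv ψ.ofConv.toLinearMap)
    (h.conv_comm (toConv χ) (toConv χ'))

end Bialgebra

section HopfAlgebra

variable {k B : Type*} [Field k] [Ring B] [HopfAlgebra k B]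

theorem IsPointed.translate_eq_self (hB : IsPointed k B) {ψ : B →ₐ[k] k}
    (hψ : ∀ g, IsGroupLikeElem k g → ψ g = 1) :
    ∀ r ∈ coradicalSubalgebra k B, translate ψ r = r := by
  suffices h : coradicalSubalgebra k B ≤ AlgHom.equalizer (translate ψ) (AlgHom.id k B) from
    fun r hr => h hr
  have hspan : coradical k B ≤ (AlgHom.equalizer (translate ψ) (AlgHom.id k B)).toSubmodule := by
    rw [hB.coradical_eq_span, Submodule.span_le]
    intro g hg
    change translate ψ g = g
    rw [translate_of_isGroupLikeElem ψ hg, hψ g hg, one_smul]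
  exact Algebra.adjoin_le hspan

theorem comul_antipode_mul {b g h : B} (hh : IsGroupLikeElem k h)
    (hb : Coalgebra.comul (R := k) b = b ⊗ₜ[k] g + h ⊗ₜ[k] b) :
    Coalgebra.comul (R := k) (HopfAlgebra.antipode k h * b) =
      (HopfAlgebra.antipode k h * b) ⊗ₜ[k] (HopfAlgebra.antipode k h * g) +
        1 ⊗ₜ[k] (HopfAlgebra.antipode k h * b) := by
  rw [Bialgebra.comul_mul, hb, hh.antipode.comul_eq_tmul_self, mul_add,
    Algebra.TensorProduct.tmul_mul_tmul, Algebra.TensorProduct.tmul_mul_tmul,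
    hh.antipode_mul_cancel]

variable (k) in
theorem subset_hopfClosure (s : Set B) : s ⊆ hopfClosure k s :=
  fun _ hx => Algebra.mem_sInf.2 fun _ hE => hE.2 hx

theorem IsSkewPrimitive.apply_eq_zero [CharZero k] (hB : IsPointed k B)
    (hB₀ : HasCommutativeCoradical k B) {ψ : B →ₐ[k] k}
    (hψ : ∀ g, IsGroupLikeElem k g → ψ g = 1) {b : B} (hb : IsSkewPrimitive k b)
    [Module.Finite (coradicalSubalgebra k B) (hopfExtension k b)] : ψ b = 0 := by
  obtain ⟨g, h, hg, hh, hcomul⟩ := hb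
  have : IsMulCommutative (coradicalSubalgebra k B) := Algebra.isMulCommutative_adjoin k hB₀
  have hmem : HopfAlgebra.antipode k h * b ∈ hopfClosure k ((coradical k B : Set B) ∪ {b}) :=
    mul_mem (subset_hopfClosure k _ (Or.inl (mem_coradical_of_isGroupLikeElem hh.antipode)))
      (subset_hopfClosure k _ (Or.inr rfl))
  have hzero : ψ (HopfAlgebra.antipode k h * b) = 0 :=
    apply_eq_zero_of_comul_eq (hB.translate_eq_self hψ) (P := hopfExtension k b)
      (one_mem (hopfClosure k _)) (fun x hx => mul_mem (S := Subalgebra k B) hx hmem)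
      (by rw [map_mul, hψ _ hh.antipode, hψ g hg, mul_one]) (comul_antipode_mul hh hcomul)
  rwa [map_mul, hψ _ hh.antipode, one_mul] at hzero

theorem eq_convOne_of_apply_eq_one [CharZero k] (hB : IsPointed k B)
    (hB₀ : HasCommutativeCoradical k B) (hgen : GeneratedByFiniteTypeSkewPrimitives k B)
    {ψ : WithConv (B →ₐ[k] k)} (hψ : ∀ g, IsGroupLikeElem k g → ψ.ofConv g = 1) : ψ = 1 := by
  have hone : ∀ g, IsGroupLikeElem k g → (1 : WithConv (B →ₐ[k] k)).ofConv g = 1 :=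
    fun g hg => hg.counit_eq_one
  refine WithConv.ext (AlgHom.ext_of_adjoin_eq_top hgen fun a ⟨ha, _, _⟩ => ?_)
  rw [ha.apply_eq_zero hB hB₀ hψ, ha.apply_eq_zero hB hB₀ hone]

/-- The inverse `χ ∘ S` of a character `χ` for convolution. -/
def convInv (χ : B →ₐ[k] k) : B →ₐ[k] k :=
  AlgHom.ofLinearMap (χ.toLinearMap ∘ₗ HopfAlgebra.antipode k)
    (by rw [LinearMap.comp_apply, HopfAlgebra.antipode_one, AlgHom.toLinearMap_apply, map_one])
    fun x y => by
      simp only [LinearMap.comp_apply, HopfAlgebra.antipode_mul_antidistrib,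
        AlgHom.toLinearMap_apply, map_mul, mul_comm]

theorem convInv_mul (χ : B →ₐ[k] k) : toConv (convInv χ) * toConv χ = 1 := by
  refine WithConv.ext (AlgHom.toLinearMap_injective ?_)
  have h := LinearMap.algHom_comp_convMul_distrib χ (toConv (HopfAlgebra.antipode k (A := B)))
    (toConv LinearMap.id)
  rw [LinearMap.antipode_mul_id] at h
  refine h.symm.trans (LinearMap.ext fun b => ?_)
  exact AlgHomClass.commutes χ (Coalgebra.counit (R := k) b)

theorem mul_convInv (χ : B →ₐ[k] k) : toConv χ * toConv (convInv χ) = 1 := by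
  refine WithConv.ext (AlgHom.toLinearMap_injective ?_)
  have h := LinearMap.algHom_comp_convMul_distrib χ (toConv LinearMap.id)
    (toConv (HopfAlgebra.antipode k (A := B)))
  rw [LinearMap.id_mul_antipode] at h
  refine h.symm.trans (LinearMap.ext fun b => ?_)
  exact AlgHomClass.commutes χ (Coalgebra.counit (R := k) b)

theorem isUnit_conv (χ : WithConv (B →ₐ[k] k)) : IsUnit χ :=
  ⟨⟨χ, toConv (convInv χ.ofConv), mul_convInv _, convInv_mul _⟩, rfl⟩

theorem groupLikesDetermineCharacters [CharZero k] (hB : IsPointed k B)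
    (hB₀ : HasCommutativeCoradical k B) (hgen : GeneratedByFiniteTypeSkewPrimitives k B) :
    GroupLikesDetermineCharacters k B := by
  intro χ χ' h
  obtain ⟨v, hv⟩ := isUnit_conv (toConv χ')
  have hquot : ↑v⁻¹ * toConv χ = 1 := by
    refine eq_convOne_of_apply_eq_one hB hB₀ hgen fun g hg => ?_
    have hinv := conv_apply_of_isGroupLikeElem ↑v⁻¹ ↑v hg
    rw [Units.inv_mul, hv] at hinv
    rw [conv_apply_of_isGroupLikeElem _ _ hg, ofConv_toConv, h g hg, ← ofConv_toConv χ', ← hinv]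
    exact hg.counit_eq_one
  rw [Units.inv_mul_eq_iff_eq_mul, mul_one, hv] at hquot
  exact congrArg ofConv hquot

end HopfAlgebra

end HopfSub

namespace CocycleTwist

open WithConv

section TwistMul

variable {k B : Type*} [Field k] [Ring B] [Bialgebra k B]

/-- Along `h` the twisted product is the conjugate of the original one by the form `σ ∘ h`. -/
theorem apply_twistMul_of_commute (σ : (WithConv (B ⊗[k] B →ₗ[k] k))ˣ) {C : Type*}
    [AddCommGroup C] [Module k C] [Coalgebra k C] (h : C →ₗc[k] B ⊗[k] B)
    {φ : WithConv (C →ₗ[k] k)} (hφ : Commute (pull k h σ.val) φ) {E : Type*} [Ring E] [Algebra k E]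
    {Φ : B →ₗ[k] E} {e : E} (hΦ : ∀ c, Φ (LinearMap.mul' k B (h c)) = φ.ofConv c • e) (c : C) :
    Φ (twistMul σ (h c)) = φ.ofConv c • e := by
  have hfactor : Φ ∘ₗ LinearMap.mul' k B ∘ₗ h.toLinearMap =
      LinearMap.toSpanSingleton k E e ∘ₗ φ.ofConv := LinearMap.ext hΦ
  have hconj : (Units.map (pull k h) σ).val * φ * ((Units.map (pull k h) σ)⁻¹).val = φ :=
    (Units.mul_inv_eq_iff_eq_mul _).2 hφ
  have htwist := congrArg (fun F => toConv (Φ ∘ₗ F.ofConv)) (twistMul_comp σ h)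
  simp only [comp_mul_scal, comp_scal_mul] at htwist
  rw [hfactor, ← comp_scal_mul, ← comp_mul_scal] at htwist
  have happly := DFunLike.congr_fun (congrArg ofConv htwist) c
  exact happly.trans
    (congrArg (fun ψ : WithConv (C →ₗ[k] k) => ψ.ofConv c • e) hconj)

end TwistMul

section GroupLike

variable {k C D : Type*} [Field k] [AddCommGroup C] [Module k C] [Coalgebra k C]
  [AddCommGroup D] [Module k D] [Coalgebra k D]

/-- The coalgebra map `k → C`, `1 ↦ g`, given by a group-like element `g`. -/
def groupLikeCoalgHom {g : C} (hg : IsGroupLikeElem k g) : k →ₗc[k] C where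
  __ := LinearMap.toSpanSingleton k C g
  counit_comp := by ext; simp [hg.counit_eq_one]
  map_comp_comul := by ext; simp [hg.comul_eq_tmul_self]

variable (D) in
/-- The coalgebra map `d ↦ g ⊗ d` given by a group-like element `g`. -/
def groupLikeTmul {g : C} (hg : IsGroupLikeElem k g) : D →ₗc[k] C ⊗[k] D :=
  ((groupLikeCoalgHom hg).rTensor D).comp (Coalgebra.TensorProduct.lid k D).symm.toCoalgHom

theorem groupLikeTmul_apply {g : C} (hg : IsGroupLikeElem k g) (d : D) :
    groupLikeTmul D hg d = g ⊗ₜ[k] d := by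
  simp [groupLikeTmul, groupLikeCoalgHom]

variable (D) in
/-- The coalgebra map `d ↦ d ⊗ g` given by a group-like element `g`. -/
def tmulGroupLike {g : C} (hg : IsGroupLikeElem k g) : D →ₗc[k] D ⊗[k] C :=
  ((groupLikeCoalgHom hg).lTensor D).comp (Coalgebra.TensorProduct.rid k k D).symm.toCoalgHom

theorem tmulGroupLike_apply {g : C} (hg : IsGroupLikeElem k g) (d : D) :
    tmulGroupLike D hg d = d ⊗ₜ[k] g := by
  simp [tmulGroupLike, groupLikeCoalgHom]

end GroupLike

end CocycleTwist

namespace SkewPairing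

open WithConv CocycleTwist HopfSub

section Product

variable {k U A : Type*} [Field k] [Ring U] [Bialgebra k U] [Ring A] [Bialgebra k A]

variable (k U A) in
/-- The coalgebra map `a ⊗ u ↦ (1 ⊗ a) ⊗ (u ⊗ 1)`, along which the twisted product computes
`inclA a * inclU u`. -/
def inclAU : A ⊗[k] U →ₗc[k] (U ⊗[k] A) ⊗[k] (U ⊗[k] A) :=
  Coalgebra.TensorProduct.map (coalgInclA k U A) (coalgInclU k U A)

theorem inclAU_tmul (a : A) (u : U) :
    inclAU k U A (a ⊗ₜ u) = ((1 : U) ⊗ₜ[k] a) ⊗ₜ[k] (u ⊗ₜ[k] (1 : A)) := by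
  simp [inclAU, coalgInclA, coalgInclU]

variable (τ : SkewPairing k U A)

theorem inclA_mul_inclU (a : A) (u : U) :
    τ.inclA a * τ.inclU u = twistMul τ.sigma (inclAU k U A (a ⊗ₜ u)) := by
  rw [inclAU_tmul]
  rfl

theorem inclU_mul_inclA (u : U) (a : A) : τ.inclU u * τ.inclA a = τ.tmul u a := by
  change τ.mulH (τ.tmul u 1) (τ.tmul 1 a) = _
  rw [mulH_one_left, one_mul]

theorem sigma_inclAU (a : A) (u : U) :
    τ.sigma.val.ofConv (inclAU k U A (a ⊗ₜ u)) = τ.form (u ⊗ₜ a) := by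
  rw [inclAU_tmul, sigma_tmul, Bialgebra.counit_one, Bialgebra.counit_one, one_mul, mul_one]

theorem mul'_inclAU (a : A) (u : U) :
    LinearMap.mul' k (U ⊗[k] A) (inclAU k U A (a ⊗ₜ u)) = u ⊗ₜ a := by
  rw [inclAU_tmul, LinearMap.mul'_apply, Algebra.TensorProduct.tmul_mul_tmul, one_mul, mul_one]

theorem form_mul_of_isGroupLikeElem_right {g : A} (hg : IsGroupLikeElem k g) (u u' : U) :
    τ.form ((u * u') ⊗ₜ g) = τ.form (u ⊗ₜ g) * τ.form (u' ⊗ₜ g) := by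
  rw [form_mul_left]
  have := congrArg (LinearMap.mul' k k ∘ₗ TensorProduct.map
    (τ.form ∘ₗ TensorProduct.mk k U A u) (τ.form ∘ₗ TensorProduct.mk k U A u'))
    ((Coalgebra.Repr.arbitrary k g).eq.trans hg.comul_eq_tmul_self)
  simpa using this

theorem form_mul_of_isGroupLikeElem_left {g : U} (hg : IsGroupLikeElem k g) (a a' : A) :
    τ.form (g ⊗ₜ (a * a')) = τ.form (g ⊗ₜ a) * τ.form (g ⊗ₜ a') := by
  rw [form_mul_right]
  have := congrArg (LinearMap.mul' k k ∘ₗ TensorProduct.map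
    (τ.form ∘ₗ (TensorProduct.mk k U A).flip a') (τ.form ∘ₗ (TensorProduct.mk k U A).flip a))
    ((Coalgebra.Repr.arbitrary k g).eq.trans hg.comul_eq_tmul_self)
  simpa [mul_comm] using this

/-- The character `u ↦ τ(u, g)` of `U` given by a group-like element `g` of `A`. -/
def formRight {g : A} (hg : IsGroupLikeElem k g) : U →ₐ[k] k :=
  AlgHom.ofLinearMap (τ.form ∘ₗ (TensorProduct.mk k U A).flip g)
    ((τ.form_one_left g).trans hg.counit_eq_one) (τ.form_mul_of_isGroupLikeElem_right hg)

/-- The character `a ↦ τ(g, a)` of `A` given by a group-like element `g` of `U`. -/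
def formLeft {g : U} (hg : IsGroupLikeElem k g) : A →ₐ[k] k :=
  AlgHom.ofLinearMap (τ.form ∘ₗ TensorProduct.mk k U A g)
    ((τ.form_one_right g).trans hg.counit_eq_one) (τ.form_mul_of_isGroupLikeElem_left hg)

theorem apply_idTensor_mul_of_isGroupLikeElem (hU : GroupLikesDetermineCharacters k U)
    (ρ : U →ₐ[k] k) (χ : A →ₐ[k] k) {g : A} (hg : IsGroupLikeElem k g) (u : U) :
    ρ (τ.idTensor χ (τ.inclA g * τ.inclU u)) = ρ u * χ g := by
  let h := (inclAU k U A).comp (groupLikeTmul U hg)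
  have hh : ∀ v, h v = inclAU k U A (g ⊗ₜ v) :=
    fun v => congrArg (inclAU k U A) (groupLikeTmul_apply hg v)
  have hpull : pull k h τ.sigma.val = toConv (τ.formRight hg).toLinearMap :=
    WithConv.ext (LinearMap.ext fun v =>
      (congrArg τ.sigma.val.ofConv (hh v)).trans (τ.sigma_inclAU g v))
  have hproduct : ∀ v, (ρ.toLinearMap ∘ₗ τ.idTensor χ) (LinearMap.mul' k (U ⊗[k] A) (h v)) =
      ρ v • χ g := fun v => by
    rw [hh, mul'_inclAU]
    change ρ (χ g • v) = _
    rw [map_smul, smul_eq_mul, smul_eq_mul, mul_comm]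
  rw [inclA_mul_inclU, ← hh]
  exact apply_twistMul_of_commute τ.sigma h (hpull ▸ hU.commute_toLinearMap _ ρ) hproduct u

theorem idTensor_mul_of_isGroupLikeElem (hA : GroupLikesDetermineCharacters k A)
    (χ : A →ₐ[k] k) {g : U} (hg : IsGroupLikeElem k g) (a : A) :
    τ.idTensor χ (τ.inclA a * τ.inclU g) = χ a • g := by
  let h := (inclAU k U A).comp (tmulGroupLike A hg)
  have hh : ∀ b, h b = inclAU k U A (b ⊗ₜ g) :=
    fun b => congrArg (inclAU k U A) (tmulGroupLike_apply hg b)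
  have hpull : pull k h τ.sigma.val = toConv (τ.formLeft hg).toLinearMap :=
    WithConv.ext (LinearMap.ext fun b =>
      (congrArg τ.sigma.val.ofConv (hh b)).trans (τ.sigma_inclAU b g))
  have hproduct : ∀ b, τ.idTensor χ (LinearMap.mul' k (U ⊗[k] A) (h b)) = χ b • g := fun b => by
    rw [hh, mul'_inclAU]
    rfl
  rw [inclA_mul_inclU, ← hh]
  exact apply_twistMul_of_commute τ.sigma h (hpull ▸ hA.commute_toLinearMap _ χ) hproduct a

end Product

/-! ### Weight vectors and weight functionals -/

section Weights

variable {k U A : Type*} [Field k] [Ring U] [Bialgebra k U] [Ring A] [Bialgebra k A]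
variable (τ : SkewPairing k U A)
variable {M M' : Type*} [AddCommGroup M] [Module k M] [Module τ.H M] [IsScalarTower k τ.H M]
  [AddCommGroup M'] [Module k M'] [Module τ.H M'] [IsScalarTower k τ.H M']

/-- The vectors of an `H`-module on which `A` acts through the character `χ`. -/
def weightSpace (χ : A →ₐ[k] k) : Submodule k M where
  carrier := {x | ∀ a, τ.inclA a • x = χ a • x}
  add_mem' hx hy a := by rw [smul_add, smul_add, hx, hy]
  zero_mem' a := by rw [smul_zero, smul_zero]
  smul_mem' r x hx a := by rw [smul_comm, hx, smul_comm]

/-- The functionals on an `H`-module which `U` multiplies by the character `ρ`. -/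
def coweightSpace (ρ : U →ₐ[k] k) : Submodule k (M →ₗ[k] k) where
  carrier := {f | ∀ u x, f (τ.inclU u • x) = ρ u * f x}
  add_mem' hf hg u x := by rw [LinearMap.add_apply, LinearMap.add_apply, hf, hg, mul_add]
  zero_mem' u x := by rw [LinearMap.zero_apply, LinearMap.zero_apply, mul_zero]
  smul_mem' r f hf u x := by
    rw [LinearMap.smul_apply, LinearMap.smul_apply, hf, smul_eq_mul, smul_eq_mul, mul_left_comm]

variable {τ} {ρ ρ' : U →ₐ[k] k} {χ χ' : A →ₐ[k] k}

theorem map_mem_weightSpace (φ : M →ₗ[τ.H] M') {x : M} (hx : x ∈ τ.weightSpace χ) :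
    φ x ∈ τ.weightSpace χ := fun a => by
  rw [← map_smul, hx a, LinearMap.map_smul_of_tower]

theorem comp_mem_coweightSpace (φ : M →ₗ[τ.H] M') {f : M' →ₗ[k] k}
    (hf : f ∈ τ.coweightSpace ρ) : f ∘ₗ φ.restrictScalars k ∈ τ.coweightSpace ρ := fun u x => by
  rw [LinearMap.comp_apply, LinearMap.restrictScalars_apply, map_smul, hf, LinearMap.comp_apply,
    LinearMap.restrictScalars_apply]

theorem smul_eq_inclU_smul {x : M} (hx : x ∈ τ.weightSpace χ) (y : τ.H) :
    y • x = τ.inclU (τ.idTensor χ y) • x := by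
  refine τ.tmul_induction (p := fun y => y • x = τ.inclU (τ.idTensor χ y) • x) y ?_
    (fun u a => ?_) (fun y z hy hz => ?_)
  · rw [map_zero, map_zero]
  · rw [idTensor_tmul, ← inclU_mul_inclA, mul_smul, hx, map_smul, smul_assoc, smul_comm]
  · rw [add_smul, hy, hz, map_add, map_add, add_smul]

theorem exists_inclU_smul_eq {m : M} (hm : m ∈ τ.weightSpace χ)
    (hspan : Submodule.span τ.H {m} = ⊤) (x : M) : ∃ u, τ.inclU u • m = x := by
  obtain ⟨y, rfl⟩ := Submodule.mem_span_singleton.1 (hspan ▸ Submodule.mem_top : x ∈ _)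
  exact ⟨_, (smul_eq_inclU_smul hm y).symm⟩

theorem ne_zero_of_mem_coweightSpace {m : M} (hm : m ∈ τ.weightSpace χ)
    (hspan : Submodule.span τ.H {m} = ⊤) {f : M →ₗ[k] k} (hf : f ∈ τ.coweightSpace ρ)
    (hf0 : f ≠ 0) : f m ≠ 0 := by
  refine fun hfm => hf0 (LinearMap.ext fun x => ?_)
  obtain ⟨u, rfl⟩ := exists_inclU_smul_eq hm hspan x
  rw [hf, hfm, mul_zero, LinearMap.zero_apply]

/-- The `H`-linear map `U_χ → M`, `u ↦ u m`, given by a vector `m` of weight `χ`. -/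
def indHom {m : M} (hm : m ∈ τ.weightSpace χ) : τ.Ind χ →ₗ[τ.H] M where
  toFun x := τ.inclU ((τ.toInd χ).symm x) • m
  map_add' x y := by rw [map_add, map_add, add_smul]
  map_smul' y x := by
    rw [RingHom.id_apply, ← mul_smul, smul_eq_inclU_smul hm (y * _)]
    rfl

theorem inclA_smul_inclU_smul {m : M} (hm : m ∈ τ.weightSpace χ) (a : A) (u : U) :
    τ.inclA a • τ.inclU u • m = τ.inclU (τ.idTensor χ (τ.inclA a * τ.inclU u)) • m := by
  rw [← mul_smul, smul_eq_inclU_smul hm]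

variable (τ) in
theorem inclU_smul_toInd (χ : A →ₐ[k] k) (u u' : U) :
    τ.inclU u • τ.toInd χ u' = τ.toInd χ (u * u') := by
  change τ.toInd χ (τ.idTensor χ (τ.inclU u * τ.inclU u')) = _
  rw [← map_mul]
  change τ.toInd χ (χ 1 • (u * u')) = _
  rw [map_one, one_smul]

theorem apply_eq_zero_of_mem_maxSub {x : τ.Ind χ} (hx : x ∈ τ.maxSub ρ χ) :
    ρ ((τ.toInd χ).symm x) = 0 := by
  rw [maxSub, sSup_eq_iSup'] at hx
  refine Submodule.iSup_induction _ (motive := fun x => ρ ((τ.toInd χ).symm x) = 0) hx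
    (fun W x hx => W.2 x hx) ?_ fun x y hx hy => ?_
  · rw [map_zero, map_zero]
  · rw [map_add, map_add, hx, hy, add_zero]

theorem le_maxSub {W : Submodule τ.H (τ.Ind χ)} (hW : ∀ x ∈ W, ρ ((τ.toInd χ).symm x) = 0) :
    W ≤ τ.maxSub ρ χ := le_sSup hW

variable (τ) in
/-- The data `m`, `f` of an object of `ₕM`: `m` is a generator of weight `χ`, and `f` is a
functional of weight `ρ` whose kernel contains no nonzero `H`-submodule, normalized by
`f m = 1`. -/
structure HasWeights (ρ : U →ₐ[k] k) (χ : A →ₐ[k] k) (m : M) (f : M →ₗ[k] k) : Prop where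
  mem_weightSpace : m ∈ τ.weightSpace χ
  mem_coweightSpace : f ∈ τ.coweightSpace ρ
  span_eq_top : Submodule.span τ.H {m} = ⊤
  eq_bot : ∀ W : Submodule τ.H M, (∀ x ∈ W, f x = 0) → W = ⊥
  apply_eq_one : f m = 1

namespace HasWeights

variable {m x : M} {f f' : M →ₗ[k] k}

theorem vector_ne_zero (h : τ.HasWeights ρ χ m f) : m ≠ 0 := fun h0 =>
  one_ne_zero (α := k) (by rw [← h.apply_eq_one, h0, map_zero])

theorem functional_ne_zero (h : τ.HasWeights ρ χ m f) : f ≠ 0 := fun h0 =>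
  one_ne_zero (α := k) (by rw [← h.apply_eq_one, h0, LinearMap.zero_apply])

theorem functional_surjective (h : τ.HasWeights ρ χ m f) : Function.Surjective f :=
  LinearMap.surjective_iff_ne_zero.2 h.functional_ne_zero

theorem apply_inclU_smul_self (h : τ.HasWeights ρ χ m f) (u : U) : f (τ.inclU u • m) = ρ u := by
  rw [h.mem_coweightSpace, h.apply_eq_one, mul_one]

/-- If `x` is a weight vector then `H x = U x`, on which `f` vanishes as soon as `f x = 0`. -/
theorem eq_zero_of_apply_eq_zero (h : τ.HasWeights ρ χ m f) (hx : x ∈ τ.weightSpace χ')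
    (hfx : f x = 0) : x = 0 := by
  refine Submodule.span_singleton_eq_bot.1 (h.eq_bot (Submodule.span τ.H {x}) fun z hz => ?_)
  obtain ⟨y, rfl⟩ := Submodule.mem_span_singleton.1 hz
  rw [smul_eq_inclU_smul hx, h.mem_coweightSpace, hfx, mul_zero]

theorem ker_indHom (h : τ.HasWeights ρ χ m f) :
    LinearMap.ker (indHom h.mem_weightSpace) = τ.maxSub ρ χ := by
  have hf : ∀ x : τ.Ind χ, f (indHom h.mem_weightSpace x) = ρ ((τ.toInd χ).symm x) :=
    fun x => h.apply_inclU_smul_self _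
  refine le_antisymm (le_maxSub fun x hx => ?_) fun x hx => ?_
  · rw [← hf, LinearMap.mem_ker.1 hx, map_zero]
  · have hbot : (τ.maxSub ρ χ).map (indHom h.mem_weightSpace) = ⊥ := by
      refine h.eq_bot _ ?_
      rintro _ ⟨y, hy, rfl⟩
      rw [hf, apply_eq_zero_of_mem_maxSub hy]
    exact (Submodule.eq_bot_iff _).1 hbot _ ⟨x, hx, rfl⟩

theorem nonempty_equiv_L (h : τ.HasWeights ρ χ m f) : Nonempty (M ≃ₗ[τ.H] τ.L ρ χ) := by
  have hsurj : Function.Surjective (indHom h.mem_weightSpace) := fun x =>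
    (exists_inclU_smul_eq h.mem_weightSpace h.span_eq_top x).imp fun u hu => hu
  exact ⟨((Submodule.quotEquivOfEq _ _ h.ker_indHom).symm.trans
    ((indHom h.mem_weightSpace).quotKerEquivOfSurjective hsurj)).symm⟩

theorem apply_inclA_smul (hU : GroupLikesDetermineCharacters k U) (h : τ.HasWeights ρ χ m f)
    {g : A} (hg : IsGroupLikeElem k g) (x : M) : f (τ.inclA g • x) = χ g * f x := by
  obtain ⟨u, rfl⟩ := exists_inclU_smul_eq h.mem_weightSpace h.span_eq_top x
  rw [inclA_smul_inclU_smul h.mem_weightSpace, h.apply_inclU_smul_self, h.apply_inclU_smul_self,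
    τ.apply_idTensor_mul_of_isGroupLikeElem hU ρ χ hg, mul_comm]

theorem inclU_smul (hA : GroupLikesDetermineCharacters k A) (h : τ.HasWeights ρ χ m f)
    {g : U} (hg : IsGroupLikeElem k g) : τ.inclU g • m = ρ g • m := by
  have hweight : τ.inclU g • m ∈ τ.weightSpace χ := fun a => by
    rw [inclA_smul_inclU_smul h.mem_weightSpace, τ.idTensor_mul_of_isGroupLikeElem hA χ hg,
      map_smul, smul_assoc]
  refine sub_eq_zero.1 (h.eq_zero_of_apply_eq_zero
    (sub_mem hweight (Submodule.smul_mem _ (ρ g) h.mem_weightSpace)) ?_)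
  rw [map_sub, h.apply_inclU_smul_self, map_smul, h.apply_eq_one, smul_eq_mul, mul_one, sub_self]

theorem eq_of_mem_weightSpace (hU : GroupLikesDetermineCharacters k U)
    (hA : GroupLikesDetermineCharacters k A) (h : τ.HasWeights ρ χ m f) (hx0 : x ≠ 0)
    (hx : x ∈ τ.weightSpace χ') : χ' = χ := by
  have hfx : f x ≠ 0 := fun h0 => hx0 (h.eq_zero_of_apply_eq_zero hx h0)
  refine hA _ _ fun g hg => mul_right_cancel₀ hfx ?_
  rw [← h.apply_inclA_smul hU hg, hx, map_smul, smul_eq_mul]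

theorem eq_smul_of_mem_weightSpace (h : τ.HasWeights ρ χ m f) (hx : x ∈ τ.weightSpace χ) :
    x = f x • m := by
  refine sub_eq_zero.1 (h.eq_zero_of_apply_eq_zero
    (sub_mem hx (Submodule.smul_mem _ (f x) h.mem_weightSpace)) ?_)
  rw [map_sub, map_smul, h.apply_eq_one, smul_eq_mul, mul_one, sub_self]

theorem eq_of_mem_coweightSpace (hU : GroupLikesDetermineCharacters k U)
    (hA : GroupLikesDetermineCharacters k A) (h : τ.HasWeights ρ χ m f) (hf0 : f' ≠ 0)
    (hf : f' ∈ τ.coweightSpace ρ') : ρ' = ρ := by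
  have hfm := ne_zero_of_mem_coweightSpace h.mem_weightSpace h.span_eq_top hf hf0
  refine hU _ _ fun g hg => mul_right_cancel₀ hfm ?_
  rw [← hf, h.inclU_smul hA hg, map_smul, smul_eq_mul]

theorem eq_smul_of_mem_coweightSpace (h : τ.HasWeights ρ χ m f) (hf : f' ∈ τ.coweightSpace ρ) :
    f' = f' m • f := by
  refine LinearMap.ext fun x => ?_
  obtain ⟨u, rfl⟩ := exists_inclU_smul_eq h.mem_weightSpace h.span_eq_top x
  rw [hf, LinearMap.smul_apply, h.apply_inclU_smul_self, smul_eq_mul, mul_comm]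

theorem isObject (h : τ.HasWeights ρ χ m f) : τ.IsObject M where
  exists_line := by
    refine ⟨k ∙ m, fun a x hx => ?_, finrank_span_singleton h.vector_ne_zero, ?_⟩
    · have hx' : x ∈ τ.weightSpace χ :=
        (Submodule.span_singleton_le_iff_mem _ _).2 h.mem_weightSpace hx
      rw [hx' a]
      exact Submodule.smul_mem _ _ hx
    · rw [Submodule.span_span_of_tower, h.span_eq_top]
  exists_hyperplane := by
    refine ⟨LinearMap.ker f, fun u x hx => ?_, ?_, fun W hW => h.eq_bot W fun x hx => hW hx⟩
    · rw [LinearMap.mem_ker] at hx ⊢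
      rw [h.mem_coweightSpace, hx, mul_zero]
    · rw [(f.quotKerEquivOfSurjective h.functional_surjective).finrank_eq, Module.finrank_self]

end HasWeights

end Weights

/-! ### Lines, hyperplanes and characters -/

section Characters

variable {k R S : Type*} [Field k] [Ring R] [Algebra k R] [Ring S] [Algebra k S]

theorem exists_algHom_smul_eq {V : Type*} [AddCommGroup V] [Module k V] [Module R V]
    [IsScalarTower k R V] (hV : Module.finrank k V = 1) :
    ∃ χ : R →ₐ[k] k, ∀ (r : R) (v : V), r • v = χ r • v := by
  let e : k ≃ₐ[k] Module.End k V := AlgEquiv.ofBijective (Algebra.ofId k _)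
    (LinearEquiv.smul_id_of_finrank_eq_one hV).bijective
  refine ⟨e.symm.toAlgHom.comp (Algebra.lsmul k k V), fun r v => ?_⟩
  exact (LinearMap.congr_fun (e.apply_symm_apply (Algebra.lsmul k k V r)) v).symm

theorem isScalarTower_compHom (φ : R →ₐ[k] S) (M : Type*) [AddCommGroup M] [Module k M]
    [Module S M] [IsScalarTower k S M] :
    letI := Module.compHom M φ.toRingHom
    IsScalarTower k R M :=
  letI := Module.compHom M φ.toRingHom
  ⟨fun c r x => by
    change φ (c • r) • x = c • φ r • x
    rw [map_smul, smul_assoc]⟩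

end Characters

section Objects

variable {k U A : Type*} [Field k] [Ring U] [Bialgebra k U] [Ring A] [Bialgebra k A]
variable {τ : SkewPairing k U A}
variable {M : Type*} [AddCommGroup M] [Module k M] [Module τ.H M] [IsScalarTower k τ.H M]

theorem IsASubmodule.exists_character {V : Submodule k M} (hV : τ.IsASubmodule V)
    (hV1 : Module.finrank k V = 1) :
    ∃ (m : M) (χ : A →ₐ[k] k), m ≠ 0 ∧ V = k ∙ m ∧ m ∈ τ.weightSpace χ := by
  let _ : Module A M := Module.compHom M τ.inclA.toRingHom
  have : IsScalarTower k A M := isScalarTower_compHom τ.inclA M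
  let V' : Submodule A M := { V with smul_mem' := hV }
  obtain ⟨χ, hχ⟩ := exists_algHom_smul_eq (k := k) (R := A) (V := V') hV1
  obtain ⟨⟨m, hm⟩, hm0, -⟩ := finrank_eq_one_iff'.1 hV1
  have hm0 : m ≠ 0 := fun h => hm0 (Subtype.ext h)
  exact ⟨m, χ, hm0, eq_span_singleton_of_mem_of_finrank_eq_one hV1 hm hm0,
    fun a => congrArg Subtype.val (hχ a ⟨m, hm⟩)⟩

theorem IsUSubmodule.exists_character {N : Submodule k M} (hN : τ.IsUSubmodule N)
    (hN1 : Module.finrank k (M ⧸ N) = 1) :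
    ∃ (f : M →ₗ[k] k) (ρ : U →ₐ[k] k), f ≠ 0 ∧ LinearMap.ker f = N ∧ f ∈ τ.coweightSpace ρ := by
  let _ : Module U M := Module.compHom M τ.inclU.toRingHom
  have : IsScalarTower k U M := isScalarTower_compHom τ.inclU M
  let N' : Submodule U M := { N with smul_mem' := hN }
  have hN1' : Module.finrank k (M ⧸ N') = 1 := hN1
  obtain ⟨ρ, hρ⟩ := exists_algHom_smul_eq (R := U) hN1'
  have : Module.Finite k (M ⧸ N) := Module.finite_of_finrank_pos (by omega)
  let e : (M ⧸ N) ≃ₗ[k] k :=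
    LinearEquiv.ofFinrankEq _ _ (hN1.trans (Module.finrank_self k).symm)
  have hker : LinearMap.ker (e.toLinearMap ∘ₗ N.mkQ) = N := by
    rw [LinearMap.ker_comp_of_ker_eq_bot _ e.ker, Submodule.ker_mkQ]
  refine ⟨e.toLinearMap ∘ₗ N.mkQ, ρ, ?_, hker, fun u x => ?_⟩
  · exact LinearMap.surjective_iff_ne_zero.1 (e.surjective.comp N.mkQ_surjective)
  · exact (congrArg e (hρ u (N'.mkQ x))).trans (map_smul e _ _)

theorem IsObject.exists_hasWeights (h : τ.IsObject M) :
    ∃ (ρ : U →ₐ[k] k) (χ : A →ₐ[k] k) (m : M) (f : M →ₗ[k] k), τ.HasWeights ρ χ m f := by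
  obtain ⟨V, hV, hV1, hgen⟩ := h.exists_line
  obtain ⟨N, hN, hN1, hbot⟩ := h.exists_hyperplane
  obtain ⟨m, χ, -, rfl, hm⟩ := hV.exists_character hV1
  obtain ⟨f, ρ, hf0, rfl, hf⟩ := hN.exists_character hN1
  rw [Submodule.span_span_of_tower] at hgen
  have hfm : f m ≠ 0 := ne_zero_of_mem_coweightSpace hm hgen hf hf0
  refine ⟨ρ, χ, m, (f m)⁻¹ • f, hm, Submodule.smul_mem _ _ hf, hgen,
    fun W hW => hbot W fun x hx => ?_, inv_mul_cancel₀ hfm⟩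
  have hx0 : x ∈ LinearMap.ker ((f m)⁻¹ • f) := hW x hx
  rwa [LinearMap.ker_smul _ _ (inv_ne_zero hfm)] at hx0

end Objects

/-! ### The modules `L(ρ, χ)` -/

section Quotient

variable {k U A : Type*} [Field k] [Ring U] [Bialgebra k U] [Ring A] [Bialgebra k A]
variable (τ : SkewPairing k U A)

instance instModuleIndBase (χ : A →ₐ[k] k) : Module k (τ.Ind χ) :=
  Module.compHom _ (algebraMap k τ.H)

instance instIsScalarTowerInd (χ : A →ₐ[k] k) : IsScalarTower k τ.H (τ.Ind χ) :=
  ⟨fun r y x => by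
    rw [Algebra.smul_def, mul_smul]
    rfl⟩

theorem toInd_smul (χ : A →ₐ[k] k) (r : k) (u : U) :
    τ.toInd χ (r • u) = r • τ.toInd χ u := by
  change _ = algebraMap k τ.H r • τ.toInd χ u
  rw [← AlgHom.commutes τ.inclU, inclU_smul_toInd, Algebra.smul_def]

theorem toInd_one_mem_weightSpace (χ : A →ₐ[k] k) : τ.toInd χ 1 ∈ τ.weightSpace χ := fun a => by
  change τ.toInd χ (τ.idTensor χ (τ.inclA a * τ.inclU 1)) = _
  rw [map_one, mul_one, ← toInd_smul]
  rfl

/-- The functional on `L(ρ, χ)` induced by `ρ`. -/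
def functionalL (ρ : U →ₐ[k] k) (χ : A →ₐ[k] k) : τ.L ρ χ →ₗ[k] k :=
  ((τ.maxSub ρ χ).restrictScalars k).liftQ
    { toFun := fun x => ρ ((τ.toInd χ).symm x)
      map_add' := fun x y => by rw [map_add, map_add]
      map_smul' := fun r x => by
        obtain ⟨u, rfl⟩ := (τ.toInd χ).surjective x
        rw [← toInd_smul, AddEquiv.symm_apply_apply, AddEquiv.symm_apply_apply, map_smul,
          RingHom.id_apply] }
    fun _ hx => apply_eq_zero_of_mem_maxSub hx

theorem functionalL_mk (ρ : U →ₐ[k] k) (χ : A →ₐ[k] k) (u : U) :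
    τ.functionalL ρ χ ((τ.maxSub ρ χ).mkQ (τ.toInd χ u)) = ρ u := rfl

theorem hasWeights_L (ρ : U →ₐ[k] k) (χ : A →ₐ[k] k) :
    τ.HasWeights ρ χ ((τ.maxSub ρ χ).mkQ (τ.toInd χ 1)) (τ.functionalL ρ χ) where
  mem_weightSpace := map_mem_weightSpace _ (τ.toInd_one_mem_weightSpace χ)
  mem_coweightSpace u x := by
    obtain ⟨x, rfl⟩ := (τ.maxSub ρ χ).mkQ_surjective x
    obtain ⟨v, rfl⟩ := (τ.toInd χ).surjective x
    rw [← map_smul, inclU_smul_toInd, functionalL_mk, functionalL_mk, map_mul]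
  span_eq_top := by
    refine Submodule.eq_top_iff'.2 fun x => ?_
    obtain ⟨x, rfl⟩ := (τ.maxSub ρ χ).mkQ_surjective x
    obtain ⟨v, rfl⟩ := (τ.toInd χ).surjective x
    refine Submodule.mem_span_singleton.2 ⟨τ.inclU v, ?_⟩
    rw [← map_smul, inclU_smul_toInd, mul_one]
  eq_bot W hW := by
    have hle : W.comap (τ.maxSub ρ χ).mkQ ≤ τ.maxSub ρ χ := le_maxSub fun x hx => hW _ hx
    refine (Submodule.eq_bot_iff _).2 fun x hx => ?_
    obtain ⟨x, rfl⟩ := (τ.maxSub ρ χ).mkQ_surjective x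
    exact (Submodule.Quotient.mk_eq_zero _).2 (hle hx)
  apply_eq_one := by rw [functionalL_mk, map_one]

end Quotient

end SkewPairing

/-! ### Finite-dimensional irreducible modules -/

namespace FiniteDimensionalIrreduciblesAreLines

variable {k : Type*} [Field k] {R : Type u} [Ring R] [Algebra k R]

theorem finrank_eq_one (h : FiniteDimensionalIrreduciblesAreLines k R) {V : Type*}
    [AddCommGroup V] [Module k V] [Module R V] [IsScalarTower k R V] [FiniteDimensional k V]
    [IsSimpleModule R V] : Module.finrank k V = 1 := by
  obtain ⟨I, -, ⟨e⟩⟩ := isSimpleModule_iff_quot_maximal.1 ‹IsSimpleModule R V›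
  have := (e.restrictScalars k).finiteDimensional
  have := IsSimpleModule.congr e.symm
  rw [(e.restrictScalars k).finrank_eq]
  exact h (R ⧸ I)

variable {M : Type*} [AddCommGroup M] [Module k M] [Module R M] [IsScalarTower k R M]
  [FiniteDimensional k M]

theorem exists_line_le (h : FiniteDimensionalIrreduciblesAreLines k R) {W : Submodule R M}
    (hW : W ≠ ⊥) : ∃ V ≤ W, Module.finrank k V = 1 := by
  have : IsArtinian R M := isArtinian_of_tower k inferInstance
  obtain ⟨V, hV, hVW⟩ := (IsAtomic.eq_bot_or_exists_atom_le W).resolve_left hW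
  have := isSimpleModule_iff_isAtom.2 hV
  have : FiniteDimensional k V :=
    inferInstanceAs (FiniteDimensional k (V.restrictScalars k))
  exact ⟨V, hVW, h.finrank_eq_one⟩

theorem exists_hyperplane (h : FiniteDimensionalIrreduciblesAreLines k R) [Nontrivial M] :
    ∃ N : Submodule R M, Module.finrank k (M ⧸ N) = 1 := by
  have : IsNoetherian R M := isNoetherian_of_tower k inferInstance
  obtain ⟨N, hN⟩ := IsCoatomic.exists_coatom (Submodule R M)
  have := isSimpleModule_iff_isCoatom.2 hN
  have : FiniteDimensional k (M ⧸ N) :=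
    inferInstanceAs (FiniteDimensional k (M ⧸ N.restrictScalars k))
  exact ⟨N, h.finrank_eq_one⟩

end FiniteDimensionalIrreduciblesAreLines

namespace SkewPairing

open HopfSub

section Irreducible

variable {k : Type*} [Field k] {U : Type u} [Ring U] [Bialgebra k U] {A : Type v} [Ring A]
  [Bialgebra k A] {τ : SkewPairing k U A}
variable {M : Type*} [AddCommGroup M] [Module k M] [Module τ.H M]

theorem IsObject.nontrivial (hM : τ.IsObject M) : Nontrivial M := by
  obtain ⟨V, -, hV1, -⟩ := hM.exists_line
  have : Nontrivial V := Module.nontrivial_of_finrank_pos (R := k) (by omega)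
  exact V.subtype_injective.nontrivial

variable [IsScalarTower k τ.H M]

theorem IsASubmodule.exists_line_le [FiniteDimensional k M]
    (hA : FiniteDimensionalIrreduciblesAreLines k A) {W : Submodule k M} (hW : τ.IsASubmodule W)
    (hW0 : W ≠ ⊥) : ∃ V ≤ W, τ.IsASubmodule V ∧ Module.finrank k V = 1 := by
  let _ : Module A M := Module.compHom M τ.inclA.toRingHom
  have : IsScalarTower k A M := isScalarTower_compHom τ.inclA M
  let W' : Submodule A M := { W with smul_mem' := hW }
  have hW0' : W' ≠ ⊥ := fun h => hW0 ((Submodule.eq_bot_iff W).2 ((Submodule.eq_bot_iff W').1 h))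
  obtain ⟨V, hVW, hV1⟩ := hA.exists_line_le hW0'
  exact ⟨V.restrictScalars k, hVW, fun a x hx => V.smul_mem a hx, hV1⟩

variable (τ M) in
theorem exists_hyperplane [FiniteDimensional k M] [Nontrivial M]
    (hU : FiniteDimensionalIrreduciblesAreLines k U) :
    ∃ N : Submodule k M, τ.IsUSubmodule N ∧ Module.finrank k (M ⧸ N) = 1 := by
  let _ : Module U M := Module.compHom M τ.inclU.toRingHom
  have : IsScalarTower k U M := isScalarTower_compHom τ.inclU M
  obtain ⟨N, hN⟩ := hU.exists_hyperplane (M := M)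
  exact ⟨N.restrictScalars k, fun u x hx => N.smul_mem u hx, hN⟩

variable (τ M) in
theorem isObject_of_isSimpleModule [FiniteDimensional k M] [IsSimpleModule τ.H M]
    (hU : FiniteDimensionalIrreduciblesAreLines k U)
    (hA : FiniteDimensionalIrreduciblesAreLines k A) : τ.IsObject M := by
  have : Nontrivial M := IsSimpleModule.nontrivial τ.H M
  have htop : τ.IsASubmodule (⊤ : Submodule k M) := fun _ _ _ => Submodule.mem_top
  obtain ⟨V, -, hV, hV1⟩ := htop.exists_line_le hA top_ne_bot
  obtain ⟨N, hN, hN1⟩ := τ.exists_hyperplane M hU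
  refine ⟨⟨V, hV, hV1, (eq_bot_or_eq_top _).resolve_left fun hbot => ?_⟩,
    ⟨N, hN, hN1, fun W hW => (eq_bot_or_eq_top W).resolve_right fun htop => ?_⟩⟩
  · have hV0 : V = ⊥ := (Submodule.eq_bot_iff V).2 (Submodule.span_eq_bot.1 hbot)
    rw [hV0, finrank_bot] at hV1
    exact zero_ne_one hV1
  · obtain rfl : N = ⊤ := top_le_iff.1 fun x _ => hW (htop ▸ Submodule.mem_top)
    rw [Module.finrank_zero_of_subsingleton] at hN1
    exact zero_ne_one hN1

theorem IsObject.isSimpleModule [FiniteDimensional k M]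
    (hA : FiniteDimensionalIrreduciblesAreLines k A) (hM : τ.IsObject M)
    (huniq : ∃! V : Submodule k M, τ.IsASubmodule V ∧ Module.finrank k V = 1) :
    IsSimpleModule τ.H M := by
  have := hM.nontrivial
  obtain ⟨V, hV, hV1, hgen⟩ := hM.exists_line
  refine (isSimpleModule_iff _ _).2 ⟨fun W => or_iff_not_imp_left.2 fun hW => ?_⟩
  have hWA : τ.IsASubmodule (W.restrictScalars k) := fun a x hx => W.smul_mem _ hx
  obtain ⟨V', hV'W, hV', hV1'⟩ :=
    hWA.exists_line_le hA (by rwa [Ne, Submodule.restrictScalars_eq_bot_iff])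
  obtain rfl := huniq.unique ⟨hV, hV1⟩ ⟨hV', hV1'⟩
  exact top_le_iff.1 (hgen ▸ Submodule.span_le.2 hV'W)

end Irreducible

/-! ### Uniqueness -/

section Uniqueness

variable {k U A : Type*} [Field k] [Ring U] [Bialgebra k U] [Ring A] [Bialgebra k A]
variable {τ : SkewPairing k U A}
variable {M : Type*} [AddCommGroup M] [Module k M] [Module τ.H M] [IsScalarTower k τ.H M]

theorem IsObject.existsUnique_line (hU : GroupLikesDetermineCharacters k U)
    (hA : GroupLikesDetermineCharacters k A) (hM : τ.IsObject M) :
    ∃! V : Submodule k M, τ.IsASubmodule V ∧ Module.finrank k V = 1 := by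
  obtain ⟨ρ, χ, m, f, h⟩ := hM.exists_hasWeights
  have eq_span : ∀ V : Submodule k M, τ.IsASubmodule V ∧ Module.finrank k V = 1 → V = k ∙ m := by
    rintro V ⟨hV, hV1⟩
    obtain ⟨x, χ', hx0, rfl, hx⟩ := hV.exists_character hV1
    obtain rfl := h.eq_of_mem_weightSpace hU hA hx0 hx
    have hfx : f x ≠ 0 := fun h0 => hx0 (h.eq_zero_of_apply_eq_zero hx h0)
    rw [h.eq_smul_of_mem_weightSpace hx]
    exact Submodule.span_singleton_smul_eq (IsUnit.mk0 _ hfx) m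
  obtain ⟨V, hV, hV1, -⟩ := hM.exists_line
  exact ⟨V, ⟨hV, hV1⟩, fun V' hV' => (eq_span V' hV').trans (eq_span V ⟨hV, hV1⟩).symm⟩

theorem IsObject.existsUnique_hyperplane (hU : GroupLikesDetermineCharacters k U)
    (hA : GroupLikesDetermineCharacters k A) (hM : τ.IsObject M) :
    ∃! N : Submodule k M, τ.IsUSubmodule N ∧ Module.finrank k (M ⧸ N) = 1 := by
  obtain ⟨ρ, χ, m, f, h⟩ := hM.exists_hasWeights
  have eq_ker : ∀ N : Submodule k M, τ.IsUSubmodule N ∧ Module.finrank k (M ⧸ N) = 1 →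
      N = LinearMap.ker f := by
    rintro N ⟨hN, hN1⟩
    obtain ⟨f', ρ', hf0, rfl, hf⟩ := hN.exists_character hN1
    obtain rfl := h.eq_of_mem_coweightSpace hU hA hf0 hf
    have hfm := ne_zero_of_mem_coweightSpace h.mem_weightSpace h.span_eq_top hf hf0
    rw [h.eq_smul_of_mem_coweightSpace hf, LinearMap.ker_smul _ _ hfm]
  obtain ⟨N, hN, hN1, -⟩ := hM.exists_hyperplane
  exact ⟨N, ⟨hN, hN1⟩, fun N' hN' => (eq_ker N' hN').trans (eq_ker N ⟨hN, hN1⟩).symm⟩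

theorem IsObject.existsUnique_weights (hU : GroupLikesDetermineCharacters k U)
    (hA : GroupLikesDetermineCharacters k A) (hM : τ.IsObject M) :
    ∃! p : (U →ₐ[k] k) × (A →ₐ[k] k), Nonempty (M ≃ₗ[τ.H] τ.L p.1 p.2) := by
  obtain ⟨ρ, χ, m, f, h⟩ := hM.exists_hasWeights
  refine ⟨(ρ, χ), h.nonempty_equiv_L, ?_⟩
  rintro ⟨ρ', χ'⟩ ⟨e⟩
  have hL := τ.hasWeights_L ρ' χ'
  refine Prod.ext
    (h.eq_of_mem_coweightSpace hU hA ?_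
      (comp_mem_coweightSpace e.toLinearMap hL.mem_coweightSpace))
    (h.eq_of_mem_weightSpace hU hA (e.symm.map_ne_zero_iff.2 hL.vector_ne_zero)
      (map_mem_weightSpace e.symm.toLinearMap hL.mem_weightSpace))
  exact LinearMap.surjective_iff_ne_zero.1 (hL.functional_surjective.comp e.surjective)

variable (τ) in
open scoped ModuleCat in
theorem objectProperty_L (ρ : U →ₐ[k] k) (χ : A →ₐ[k] k) :
    τ.objectProperty (ModuleCat.of τ.H (τ.L ρ χ)) :=
  (τ.hasWeights_L ρ χ).isObject

end Uniqueness

open CategoryTheory in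
open scoped ModuleCat in
theorem bijective_isoClass_L {k : Type*} [Field k] {U : Type u} [Ring U] [Bialgebra k U]
    {A : Type v} [Ring A] [Bialgebra k A] (τ : SkewPairing k U A)
    (hU : GroupLikesDetermineCharacters k U) (hA : GroupLikesDetermineCharacters k A) :
    Function.Bijective (fun p : (U →ₐ[k] k) × (A →ₐ[k] k) =>
      (Quotient.mk _ ⟨ModuleCat.of τ.H (τ.L p.1 p.2), τ.objectProperty_L p.1 p.2⟩ :
        SkewPairing.IsoClasses.{u} τ)) := by
  have existsUnique : ∀ M : ModuleCat.{u} τ.H, τ.IsObject M →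
      ∃! p : (U →ₐ[k] k) × (A →ₐ[k] k), Nonempty (M ≃ₗ[τ.H] τ.L p.1 p.2) :=
    fun M hM => hM.existsUnique_weights hU hA
  constructor
  · intro p q hpq
    obtain ⟨e⟩ := Quotient.exact hpq
    exact (existsUnique (ModuleCat.of τ.H (τ.L p.1 p.2)) (τ.objectProperty_L p.1 p.2)).unique
      ⟨LinearEquiv.refl _ _⟩
      ⟨(((τ.objectProperty).ι.mapIso e).toLinearEquiv : τ.L p.1 p.2 ≃ₗ[τ.H] τ.L q.1 q.2)⟩
  · intro c
    induction c using Quotient.inductionOn with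
    | h X =>
      obtain ⟨p, ⟨e⟩, -⟩ := existsUnique X.obj X.property
      exact ⟨p, Quotient.sound ⟨(ObjectProperty.isoMk _ e.toModuleIso).symm⟩⟩

end SkewPairing

end

theorem mainTheorem6_general {k : Type*} [Field k] {U : Type u} [Ring U] [HopfAlgebra k U]
    {A : Type v} [Ring A] [HopfAlgebra k A] (hU : HopfSub.GroupLikesDetermineCharacters k U)
    (hA : HopfSub.GroupLikesDetermineCharacters k A) (τ : SkewPairing k U A) :
    ((∀ ρ : WithConv (U →ₐ[k] k), IsUnit ρ) ∧
      (∀ ρ ρ' : WithConv (U →ₐ[k] k), ρ * ρ' = ρ' * ρ)) ∧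
    ((∀ χ : WithConv (A →ₐ[k] k), IsUnit χ) ∧
      (∀ χ χ' : WithConv (A →ₐ[k] k), χ * χ' = χ' * χ)) ∧
    (∃ hL : ∀ (ρ : U →ₐ[k] k) (χ : A →ₐ[k] k), τ.objectProperty (ModuleCat.of τ.H (τ.L ρ χ)),
      Function.Bijective (fun p : (U →ₐ[k] k) × (A →ₐ[k] k) =>
        (Quotient.mk _ ⟨ModuleCat.of τ.H (τ.L p.1 p.2), hL p.1 p.2⟩ :
          SkewPairing.IsoClasses.{u} τ))) ∧
    (∀ (M : Type w) [AddCommGroup M] [Module k M] [Module τ.H M] [IsScalarTower k τ.H M],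
      τ.IsObject M →
        ∃! p : (U →ₐ[k] k) × (A →ₐ[k] k), Nonempty (M ≃ₗ[τ.H] τ.L p.1 p.2)) ∧
    (∀ (M : Type w) [AddCommGroup M] [Module k M] [Module τ.H M] [IsScalarTower k τ.H M],
      τ.IsObject M →
        (∃! V : Submodule k M, τ.IsASubmodule V ∧ Module.finrank k V = 1) ∧
        (∃! N : Submodule k M, τ.IsUSubmodule N ∧ Module.finrank k (M ⧸ N) = 1)) ∧
    (FiniteDimensionalIrreduciblesAreLines k U → FiniteDimensionalIrreduciblesAreLines k A →
      ∀ (M : Type w) [AddCommGroup M] [Module k M] [Module τ.H M] [IsScalarTower k τ.H M]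
        [FiniteDimensional k M], IsSimpleModule τ.H M ↔ τ.IsObject M) := by
  refine ⟨⟨HopfSub.isUnit_conv, hU.conv_comm⟩, ⟨HopfSub.isUnit_conv, hA.conv_comm⟩,
    ⟨τ.objectProperty_L, τ.bijective_isoClass_L hU hA⟩,
    fun M _ _ _ _ hM => hM.existsUnique_weights hU hA,
    fun M _ _ _ _ hM => ⟨hM.existsUnique_line hU hA, hM.existsUnique_hyperplane hU hA⟩,
    fun hUl hAl M _ _ _ _ _ => ⟨fun _ => τ.isObject_of_isSimpleModule M hUl hAl,
      fun hM => hM.isSimpleModule hAl (hM.existsUnique_line hU hA)⟩⟩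

theorem mainTheorem6 {k : Type*} [Field k] [IsAlgClosed k] [CharZero k]
    {U : Type u} [Ring U] [HopfAlgebra k U] {A : Type v} [Ring A] [HopfAlgebra k A]
    (hU : HopfSub.IsPointed k U) (hA : HopfSub.IsPointed k A)
    (hU₀ : HopfSub.HasCommutativeCoradical k U) (hA₀ : HopfSub.HasCommutativeCoradical k A)
    (hUgen : HopfSub.GeneratedByFiniteTypeSkewPrimitives k U)
    (hAgen : HopfSub.GeneratedByFiniteTypeSkewPrimitives k A)
    (τ : SkewPairing k U A) :
    -- `Alg(U, k)` and `Alg(A, k)` are abelian groups under convolution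
    ((∀ ρ : WithConv (U →ₐ[k] k), IsUnit ρ) ∧
      (∀ ρ ρ' : WithConv (U →ₐ[k] k), ρ * ρ' = ρ' * ρ)) ∧
    ((∀ χ : WithConv (A →ₐ[k] k), IsUnit χ) ∧
      (∀ χ χ' : WithConv (A →ₐ[k] k), χ * χ' = χ' * χ)) ∧
    -- a) the `L(ρ, χ)` are objects, and `(ρ, χ) ↦ [L(ρ, χ)]` is a bijection onto `[ₕM]`
    (∃ hL : ∀ (ρ : U →ₐ[k] k) (χ : A →ₐ[k] k), τ.objectProperty (ModuleCat.of τ.H (τ.L ρ χ)),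
      Function.Bijective (fun p : (U →ₐ[k] k) × (A →ₐ[k] k) =>
        (Quotient.mk _ ⟨ModuleCat.of τ.H (τ.L p.1 p.2), hL p.1 p.2⟩ :
          SkewPairing.IsoClasses.{u} τ))) ∧
    -- a) for objects in an arbitrary universe
    (∀ (M : Type w) [AddCommGroup M] [Module k M] [Module τ.H M] [IsScalarTower k τ.H M],
      τ.IsObject M →
        ∃! p : (U →ₐ[k] k) × (A →ₐ[k] k), Nonempty (M ≃ₗ[τ.H] τ.L p.1 p.2)) ∧
    -- b) uniqueness of the line and of the hyperplane
    (∀ (M : Type w) [AddCommGroup M] [Module k M] [Module τ.H M] [IsScalarTower k τ.H M],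
      τ.IsObject M →
        (∃! V : Submodule k M, τ.IsASubmodule V ∧ Module.finrank k V = 1) ∧
        (∃! N : Submodule k M, τ.IsUSubmodule N ∧ Module.finrank k (M ⧸ N) = 1)) ∧
    -- c) finite-dimensional irreducible `H`-modules
    (FiniteDimensionalIrreduciblesAreLines k U → FiniteDimensionalIrreduciblesAreLines k A →
      ∀ (M : Type w) [AddCommGroup M] [Module k M] [Module τ.H M] [IsScalarTower k τ.H M]
        [FiniteDimensional k M], IsSimpleModule τ.H M ↔ τ.IsObject M) := by
  exact mainTheorem6_general (HopfSub.groupLikesDetermineCharacters hU hU₀ hUgen)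
    (HopfSub.groupLikesDetermineCharacters hA hA₀ hAgen) τ
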